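/- Let $X$ be a countable set and let $k:X\times X\to\mathbb R$ be the rates of a continuous-time Markov chain: $k(x,y)\ge 0$ for $x\ne y$, $\sum_{y\in X}k(x,y)=0$, and for every $x\in X$ $$M_1(x)=\sum_{y\neq x}k(x,y)<\infty,\qquad M_2(x)=\sum_{y\ne x}k(x,y)\sum_{z\neq y}k(y,z)<\infty .$$ Let $Lf(x)=\sum_{y}k(x,y)(f(y)-f(x))$. Assume that the chain is irreducible and positive recurrent, and that it is reversible with respect to a probability measure $\mu$ on $X$, i.e. $\mu(\{x\})k(x,y)=\mu(\{y\})k(y,x)$ for all $x,y\in X$. For $H:\mathbb R\to\mathbb R$ put $$\Psi_H(f)(x)=\sum_y k(x,y)H(f(y)-f(x)),\qquad B_H(f,g)(x)=\sum_y k(x,y)H(f(y)-f(x))(g(y)-g(x)),$$ $$\Psi_{2,H}(f)=\tfrac12\big(L\Psi_H(f)-B_{H'}(f,Lf)\big),$$ and let $\Upsilon(r)=e^r-r-1$. For $\kappa\in\mathbb R$ and $n\in(0,\infty)$, $L$ satisfies $CD_\Upsilon(\kappa,n)$ if for all bounded $f:X\to\mathbb R$ and all $x\in X$ $$\Psi_{2,\Upsilon}(f)(x)\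 \ge\ \kappa\,\Psi_\Upsilon(f)(x)+\frac1n\big(\max\{-Lf(x),0\}\big)^2 .$$ With $\Gamma(f)(x)=\frac12\sum_yk(x,y)(f(y)-f(x))^2$, call $f:X\to\mathbb R$ Lipschitz if $\Gamma(f)$ is finite everywhere and bounded, and put $\|f\|_{\mathrm{Lip}}=\sqrt{\|\Gamma(f)\|_\infty}$, $$\varrho(x,y)=\sup\{f(y)-f(x): f \text{ Lipschitz},\ \|f\|_{\mathrm{Lip}}\le 1\},\qquad \mathrm{diam}_\varrho=\sup_{x,y\in X}\varrho(x,y).$$ If $M_1\in\ell^2(\mu)$, $M_2\in\ell^1(\mu)$ and $L$ satisfies $CD_\Upsilon(\kappa,n)$ with $\kappa>0$ and $0<n<\infty$, then $$\mathrm{diam}_\varrho\ \le\ \pi\sqrt{\frac n\kappa}.$$ -/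

import Mathlib

open MeasureTheory ProbabilityTheory
open scoped ENNReal NNReal

noncomputable section

/-- Jump rates of a time-homogeneous continuous-time Markov chain on `X`: off the diagonal
`k x y ≥ 0` is the rate of jumping from `x` to `y`, every row of `k` sums to `0`
(so `k x x = -∑_{y ≠ x} k x y`), and `∑_{y ≠ x} k x y ∑_{z ≠ y} k y z` is finite for every `x`. -/
structure MarkovGenerator (X : Type*) where
  k : X → X → ℝ
  nonneg : ∀ x y, x ≠ y → 0 ≤ k x y
  hasSum_zero : ∀ x, HasSum (k x) 0
  summable_two_step : ∀ x,
    Summable fun y : {y : X // y ≠ x} => k x y * ∑' z : {z : X // z ≠ (y : X)}, k y z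

namespace MarkovGenerator

variable {X : Type*} (Q : MarkovGenerator X)

/-- `M₁(x) = ∑_{y ≠ x} k(x,y)`, the total jump rate at `x`. -/
def M₁ (x : X) : ℝ := ∑' y : {y : X // y ≠ x}, Q.k x y

/-- `M₂(x) = ∑_{y ≠ x} k(x,y) ∑_{z ≠ y} k(y,z)`. -/
def M₂ (x : X) : ℝ :=
  ∑' y : {y : X // y ≠ x}, Q.k x y * ∑' z : {z : X // z ≠ (y : X)}, Q.k y z

/-- Any state can be reached from any other one through jumps of positive rate. -/
def Irreducible : Prop :=
  ∀ x y : X, Relation.ReflTransGen (fun a b => a ≠ b ∧ 0 < Q.k a b) x y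

/-- Detailed balance of the measure `μ` with the rates. -/
def DetailedBalance [MeasurableSpace X] (μ : Measure X) : Prop :=
  ∀ x y : X, μ.real {x} * Q.k x y = μ.real {y} * Q.k y x

/-! ### The Markov chain generated by the rates -/

theorem tsum_jump (x : X) (hx : 0 < Q.M₁ x) [DecidableEq X] :
    ∑' y, (if y = x then 0 else ENNReal.ofReal (Q.k x y) / ENNReal.ofReal (Q.M₁ x)) = 1 := by
  have h1 : ∑' y : {y : X // y ≠ x}, ENNReal.ofReal (Q.k x y) = ENNReal.ofReal (Q.M₁ x) := by
    rw [M₁, ENNReal.ofReal_tsum_of_nonneg]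
    · exact fun y => Q.nonneg x y (Ne.symm y.2)
    · exact (Q.hasSum_zero x).summable.subtype {y | y ≠ x}
  have h2 : (∑' y, (if y = x then 0 else ENNReal.ofReal (Q.k x y) / ENNReal.ofReal (Q.M₁ x)))
      = ∑' y : {y : X // y ≠ x}, ENNReal.ofReal (Q.k x y) / ENNReal.ofReal (Q.M₁ x) := by
    rw [← tsum_subtype_eq_of_support_subset (s := {y | y ≠ x})]
    · refine tsum_congr fun y => ?_
      rw [if_neg y.2]
    · intro y hy h
      simp [h] at hy
  rw [h2]
  simp only [div_eq_mul_inv]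
  rw [ENNReal.tsum_mul_right, h1, ENNReal.mul_inv_cancel] <;> simp [hx]

open Classical in
/-- Distribution of the state after a jump from `x`: `y ≠ x` has probability `k(x,y) / M₁(x)`.
A state with `M₁(x) = 0` is absorbing. -/
def jumpPMF (x : X) : PMF X :=
  if hx : 0 < Q.M₁ x then
    ⟨fun y => if y = x then 0 else ENNReal.ofReal (Q.k x y) / ENNReal.ofReal (Q.M₁ x),
      Q.tsum_jump x hx ▸ ENNReal.summable.hasSum⟩
  else PMF.pure x

section Chain

variable [MeasurableSpace X] [DiscreteMeasurableSpace X]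

/-- Transition kernel of the embedded jump chain. -/
def jumpKernel : Kernel X X where
  toFun x := (Q.jumpPMF x).toMeasure
  measurable' := Measurable.of_discrete

instance : IsMarkovKernel Q.jumpKernel :=
  ⟨fun x => inferInstanceAs (IsProbabilityMeasure (Q.jumpPMF x).toMeasure)⟩

/-- Law of the embedded jump chain `(Yₙ)` started at `x`. -/
def jumpChainLaw (x : X) : Measure (ℕ → X) :=
  Kernel.trajMeasure (X := fun _ => X) (Measure.dirac x) fun n =>
    Q.jumpKernel.comap (fun h : (Finset.Iic n → X) => h ⟨n, Finset.mem_Iic.2 le_rfl⟩)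
      (measurable_pi_apply _)

/-- Law of the chain started at `x`, on pairs `(Y, T)` of a jump chain `Y` and an independent
i.i.d. sequence `T` of standard exponential variables. -/
def law (x : X) : Measure ((ℕ → X) × (ℕ → ℝ)) :=
  (Q.jumpChainLaw x).prod (Measure.infinitePi fun _ : ℕ => expMeasure 1)

end Chain

/-- Time of the `n`-th jump, `Jₙ = ∑_{m < n} T_m / M₁(Y_m)`: the holding time at the state `Y_m` is
exponential with parameter `M₁(Y_m)` (and infinite if this is `0`). -/
def jumpTime (n : ℕ) (ω : (ℕ → X) × (ℕ → ℝ)) : ℝ≥0∞ :=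
  ∑ m ∈ Finset.range n, ENNReal.ofReal (ω.2 m) / ENNReal.ofReal (Q.M₁ (ω.1 m))

open Classical in
/-- The (minimal) continuous-time chain: `Z_t = Yₙ` for `Jₙ ≤ t < J_{n+1}`, and the cemetery
state `none` after explosion. -/
def chain (t : ℝ≥0) (ω : (ℕ → X) × (ℕ → ℝ)) : Option X :=
  if h : ∃ n, Q.jumpTime n ω ≤ t ∧ (t : ℝ≥0∞) < Q.jumpTime (n + 1) ω then
    some (ω.1 (Nat.find h))
  else none

/-- First time, from the first jump on, at which the chain is at `x` (`∞` if there is none). -/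
def returnTime (x : X) (ω : (ℕ → X) × (ℕ → ℝ)) : ℝ≥0∞ :=
  ⨅ (t : ℝ≥0) (_ : Q.jumpTime 1 ω ≤ t ∧ Q.chain t ω = some x), (t : ℝ≥0∞)

/-- Positive recurrence: every state is absorbing or has finite expected return time. -/
def PositiveRecurrent [MeasurableSpace X] [DiscreteMeasurableSpace X] : Prop :=
  ∀ x : X, Q.M₁ x = 0 ∨ ∫⁻ ω, Q.returnTime x ω ∂(Q.law x) < ∞

/-! ### The operators and the curvature-dimension condition -/

/-- The generator, `L f(x) = ∑_y k(x,y) (f(y) - f(x))`. -/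
def L (f : X → ℝ) (x : X) : ℝ := ∑' y, Q.k x y * (f y - f x)

/-- `Ψ_H(f)(x) = ∑_y k(x,y) H(f(y) - f(x))`. -/
def Psi (H : ℝ → ℝ) (f : X → ℝ) (x : X) : ℝ := ∑' y, Q.k x y * H (f y - f x)

/-- `B_H(f,g)(x) = ∑_y k(x,y) H(f(y) - f(x)) (g(y) - g(x))`. -/
def B (H : ℝ → ℝ) (f g : X → ℝ) (x : X) : ℝ := ∑' y, Q.k x y * H (f y - f x) * (g y - g x)

/-- `Ψ_{2,H}(f) = (L Ψ_H(f) - B_{H'}(f, L f)) / 2`. -/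
def Psi₂ (H : ℝ → ℝ) (f : X → ℝ) (x : X) : ℝ :=
  (Q.L (Q.Psi H f) x - Q.B (deriv H) f (Q.L f) x) / 2

/-- `Υ(r) = e^r - r - 1`. -/
def Upsilon (r : ℝ) : ℝ := Real.exp r - r - 1

/-- The condition `CD_Υ(κ,F)`: `Ψ_{2,Υ}(f) ≥ κ Ψ_Υ(f) + F₀(-L f)` on `X` for all bounded `f`, where
`F₀` is `F` on `[0,∞)` and `0` on `(-∞,0)`; only the values of `F` on `[0,∞)` matter. -/
def CDUpsilon (κ : ℝ) (F : ℝ → ℝ) : Prop :=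
  ∀ f : X → ℝ, (∃ C, ∀ x, |f x| ≤ C) → ∀ x,
    κ * Q.Psi Upsilon f x + (Set.Ici 0).indicator F (-Q.L f x) ≤ Q.Psi₂ Upsilon f x

/-- The condition `CD_Υ(κ,n)`, i.e. `CD_Υ(κ,F)` with `F(r) = r²/n`. -/
def CDUpsilonDim (κ n : ℝ) : Prop := Q.CDUpsilon κ fun r => r ^ 2 / n

/-! ### Lipschitz functions and the resistance diameter -/

/-- The carré du champ `Γ(f)(x) = ½ ∑_y k(x,y) (f(y) - f(x))²`. -/
def Gam (f : X → ℝ) : X → ℝ := Q.Psi (fun r => r ^ 2 / 2) f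

/-- `f` is a Lipschitz function: the sums defining `Γ(f)` converge and `Γ(f)` is bounded. -/
def IsLipschitz (f : X → ℝ) : Prop :=
  (∀ x, Summable fun y => Q.k x y * ((f y - f x) ^ 2 / 2)) ∧ BddAbove (Set.range (Q.Gam f))

/-- `‖f‖_Lip = √‖Γ(f)‖_∞` (for a Lipschitz function `f`; note `Γ(f) ≥ 0`). -/
def lipNorm (f : X → ℝ) : ℝ := √(⨆ x, Q.Gam f x)

/-- `ϱ(x,y) = sup {f(y) - f(x) : ‖f‖_Lip ≤ 1}`, in the extended reals. -/
def varrho (x y : X) : EReal :=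
  sSup {r : EReal | ∃ f : X → ℝ, (Q.IsLipschitz f ∧ Q.lipNorm f ≤ 1) ∧ r = ((f y - f x : ℝ) : EReal)}

/-- The resistance diameter `diam_ϱ = sup_{x,y} ϱ(x,y)`. -/
def diam : EReal := ⨆ (x : X) (y : X), Q.varrho x y

end MarkovGenerator

end

set_option linter.unusedSectionVars false

noncomputable section

/-! The bound follows from the entropy-information inequality Ent(f) ≤ (n/2) log(1 + I(f)/(nκ)) for
probability densities f, where I is the Fisher information (`entropy_le_log_fisher`), and a Herbst
argument.

Formally, along the heat flow Ent' = -I and I' = -2∫ u Ψ₂(log u) ≤ -2κI - 2I²/n, so (n/2) log(1 +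
I/(nκ)) decreases at least as fast as Ent, and both tend to 0. The flow is replaced by implicit
Euler steps u - εLu = f. Convexity of I gives the exact discrete decay of I
(`fisher_resolvent_step`). The errors in the entropy balance telescope (`entropy_le_add`) and vanish
as ε → 0.

For bounded h with Γ(h) ≤ 1 the density proportional to e^{th} has I ≤ t²
(`fisher_le_of_Gam_le_one`). With G the cumulant generating function of h, the inequality reads
(G/t)' ≤ (n/2) log(1 + t²/(nκ))/t². Integrating over (0,∞) gives sup h - ∫h ≤ (π/2)√(n/κ)
(`sub_integral_le`); the same bound for -h doubles the constant. Clamping reduces Lipschitz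
functions to bounded ones. -/

theorem integrable_iff_summable_of_countable {α : Type*} [Countable α] [MeasurableSpace α]
    [MeasurableSingletonClass α] (ν : Measure α) [IsFiniteMeasure ν] (f : α → ℝ) :
    Integrable f ν ↔ Summable fun a => ν.real {a} * f a := by
  rw [← Measure.sum_smul_dirac ν, integrable_sum_dirac_iff (by simp), Measure.sum_smul_dirac,
    ← summable_abs_iff (f := fun a => ν.real {a} * f a)]
  simp only [abs_mul, Measure.real, abs_of_nonneg ENNReal.toReal_nonneg, Real.norm_eq_abs]

/-! ### Off-diagonal rates and the symmetric measure on jumps. -/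

namespace MarkovGenerator

variable {X : Type*} (Q : MarkovGenerator X)

open Classical in
/-- The rates with the diagonal replaced by `0`. -/
def rate (x y : X) : ℝ := if y = x then 0 else Q.k x y

theorem rate_of_ne {x y : X} (h : y ≠ x) : Q.rate x y = Q.k x y := by simp [rate, h]

theorem rate_nonneg (x y : X) : 0 ≤ Q.rate x y := by
  unfold rate
  split_ifs with h
  · exact le_rfl
  · exact Q.nonneg x y (Ne.symm h)

theorem rate_eq_indicator (x : X) : Q.rate x = Set.indicator {y | y ≠ x} (Q.k x) := by
  ext y
  by_cases h : y = x <;> simp [rate, h]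

theorem summable_rate (x : X) : Summable (Q.rate x) := by
  rw [rate_eq_indicator]
  exact (Q.hasSum_zero x).summable.indicator _

theorem tsum_rate (x : X) : ∑' y, Q.rate x y = Q.M₁ x := by
  rw [rate_eq_indicator, M₁]
  exact (tsum_subtype {y | y ≠ x} (Q.k x)).symm

theorem M₁_nonneg (x : X) : 0 ≤ Q.M₁ x := by
  rw [← tsum_rate]; exact tsum_nonneg (Q.rate_nonneg x)

/-- The sum `∑_{y ≠ x} k(x,y) F(x,y)`. -/
def jumpSum (F : X × X → ℝ) (x : X) : ℝ := ∑' y, Q.rate x y * F (x, y)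

/-- Increments vanish on the diagonal, so the negative rate `k x x` may be dropped and every sum has
nonnegative weights. -/
theorem L_eq_jumpSum (f : X → ℝ) (x : X) : Q.L f x = Q.jumpSum (fun p => f p.2 - f p.1) x := by
  refine tsum_congr fun y => ?_
  by_cases h : y = x
  · simp [h]
  · simp [Q.rate_of_ne h]

theorem Psi_eq_jumpSum {H : ℝ → ℝ} (hH : H 0 = 0) (f : X → ℝ) (x : X) :
    Q.Psi H f x = Q.jumpSum (fun p => H (f p.2 - f p.1)) x := by
  refine tsum_congr fun y => ?_
  by_cases h : y = x
  · simp [h, hH]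
  · simp [Q.rate_of_ne h]

theorem B_eq_jumpSum (H : ℝ → ℝ) (f g : X → ℝ) (x : X) :
    Q.B H f g x = Q.jumpSum (fun p => H (f p.2 - f p.1) * (g p.2 - g p.1)) x := by
  refine tsum_congr fun y => ?_
  by_cases h : y = x
  · simp [h]
  · simp [Q.rate_of_ne h, mul_assoc]

theorem jumpSum_left_mul (u : X → ℝ) (F : X × X → ℝ) (x : X) :
    Q.jumpSum (fun p => u p.1 * F p) x = u x * Q.jumpSum F x := by
  unfold jumpSum
  rw [← tsum_mul_left]
  exact tsum_congr fun y => by ring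

theorem jumpSum_sub {F G : X × X → ℝ} {x : X} (hF : Summable fun y => Q.rate x y * F (x, y))
    (hG : Summable fun y => Q.rate x y * G (x, y)) :
    Q.jumpSum (fun p => F p - G p) x = Q.jumpSum F x - Q.jumpSum G x := by
  unfold jumpSum
  rw [← hF.tsum_sub hG]
  exact tsum_congr fun y => by ring

theorem jumpSum_le {F G : X × X → ℝ} {x : X} (hF : Summable fun y => Q.rate x y * F (x, y))
    (hG : Summable fun y => Q.rate x y * G (x, y)) (h : ∀ y, F (x, y) ≤ G (x, y)) :
    Q.jumpSum F x ≤ Q.jumpSum G x :=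
  hF.tsum_le_tsum (fun y => mul_le_mul_of_nonneg_left (h y) (Q.rate_nonneg x y)) hG

theorem DetailedBalance.rate {Q : MarkovGenerator X} [MeasurableSpace X] {μ : Measure X}
    (hμ : Q.DetailedBalance μ) (x y : X) :
    μ.real {x} * Q.rate x y = μ.real {y} * Q.rate y x := by
  by_cases h : y = x
  · simp [h]
  · rw [Q.rate_of_ne h, Q.rate_of_ne (Ne.symm h), hμ x y]

/-- The measure on pairs of states with weight `μ({x}) k(x,y)` at `(x, y)`, `x ≠ y`. -/
def jumpMeasure [MeasurableSpace X] (μ : Measure X) : Measure (X × X) :=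
  Measure.sum fun p => ENNReal.ofReal (μ.real {p.1} * Q.rate p.1 p.2) • Measure.dirac p

/-- Reversibility with respect to a fully supported measure for which the jump rate is square
integrable. -/
structure Regular [MeasurableSpace X] (μ : Measure X) : Prop where
  reversible : Q.DetailedBalance μ
  pos : ∀ x, 0 < μ.real {x}
  integrable_sq : Integrable (fun x => Q.M₁ x ^ 2) μ

namespace Regular

variable {Q} [Countable X] [MeasurableSpace X] [DiscreteMeasurableSpace X]
  {μ : Measure X} [IsProbabilityMeasure μ]

theorem integrable_M₁ (hQ : Q.Regular μ) : Integrable Q.M₁ μ := by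
  refine (hQ.integrable_sq.add (integrable_const 1)).mono' .of_discrete (.of_forall fun x => ?_)
  rw [Real.norm_eq_abs, abs_of_nonneg (Q.M₁_nonneg x)]
  simp only [Pi.add_apply]
  nlinarith [sq_nonneg (Q.M₁ x - 1), Q.M₁_nonneg x]

/-- By Tonelli: summing over the target of the jump turns the weight into `M₁`. -/
theorem summable_weight_mul {g : X → ℝ} (hg : ∀ x, 0 ≤ g x)
    (hi : Integrable (fun x => g x * Q.M₁ x) μ) :
    Summable fun p : X × X => μ.real {p.1} * Q.rate p.1 p.2 * g p.1 := by
  rw [summable_prod_of_nonneg fun p => mul_nonneg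
    (mul_nonneg measureReal_nonneg (Q.rate_nonneg _ _)) (hg _)]
  refine ⟨fun x => ?_, ?_⟩
  · exact ((Q.summable_rate x).mul_left (μ.real {x})).mul_right (g x)
  rw [integrable_iff_summable_of_countable] at hi
  refine hi.congr fun x => ?_
  simp only
  rw [tsum_mul_right, tsum_mul_left, tsum_rate]
  ring

theorem summable_weight (hQ : Q.Regular μ) :
    Summable fun p : X × X => μ.real {p.1} * Q.rate p.1 p.2 := by
  have h := summable_weight_mul (g := fun _ => 1) (fun _ => zero_le_one)
    (by simp only [one_mul]; exact hQ.integrable_M₁)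
  exact h.congr fun p => mul_one _

theorem isFiniteMeasure (hQ : Q.Regular μ) : IsFiniteMeasure (Q.jumpMeasure μ) := by
  constructor
  rw [jumpMeasure, Measure.sum_apply _ MeasurableSet.univ]
  simp only [Measure.smul_apply, measure_univ, smul_eq_mul, mul_one]
  exact hQ.summable_weight.tsum_ofReal_lt_top

theorem jumpMeasure_real_singleton (p : X × X) :
    (Q.jumpMeasure μ).real {p} = μ.real {p.1} * Q.rate p.1 p.2 := by
  rw [jumpMeasure, Measure.real, Measure.sum_smul_dirac_singleton, ENNReal.toReal_ofReal]
  exact mul_nonneg measureReal_nonneg (Q.rate_nonneg _ _)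

theorem integrable_iff (hQ : Q.Regular μ) {F : X × X → ℝ} :
    Integrable F (Q.jumpMeasure μ) ↔
      Summable fun p : X × X => μ.real {p.1} * Q.rate p.1 p.2 * F p := by
  have := hQ.isFiniteMeasure
  simp [integrable_iff_summable_of_countable, jumpMeasure_real_singleton]

theorem integral_eq_tsum (hQ : Q.Regular μ) {F : X × X → ℝ}
    (hF : Integrable F (Q.jumpMeasure μ)) :
    ∫ p, F p ∂Q.jumpMeasure μ = ∑' p : X × X, μ.real {p.1} * Q.rate p.1 p.2 * F p := by
  have := hQ.isFiniteMeasure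
  simp [integral_countable hF, jumpMeasure_real_singleton]

/-- Here `M₁ ∈ L²(μ)` enters: integrating `M₁` at the start of a jump against the jump measure gives
∫ M₁² dμ. It makes `L` and `Psi` of bounded functions integrable on jumps. -/
theorem integrable_fst (hQ : Q.Regular μ) {g : X → ℝ} {C : ℝ} (hg : ∀ x, |g x| ≤ C * Q.M₁ x) :
    Integrable (fun p : X × X => g p.1) (Q.jumpMeasure μ) := by
  have h : Integrable (fun p : X × X => Q.M₁ p.1) (Q.jumpMeasure μ) :=
    hQ.integrable_iff.2 (summable_weight_mul Q.M₁_nonneg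
      (by simpa [sq] using hQ.integrable_sq))
  exact (h.const_mul C).mono' .of_discrete (.of_forall fun p => hg p.1)

/-- Detailed balance says that the jump measure is symmetric. The form as a composition with an
equivalence serves both summability and the value of the sum. -/
theorem summable_swap (hQ : Q.Regular μ) (F : X × X → ℝ) :
    (fun p : X × X => μ.real {p.1} * Q.rate p.1 p.2 * F p.swap) =
      (fun p : X × X => μ.real {p.1} * Q.rate p.1 p.2 * F p) ∘ Equiv.prodComm X X := by
  ext p
  simp [hQ.reversible.rate p.1 p.2]

theorem integrable_swap (hQ : Q.Regular μ) {F : X × X → ℝ}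
    (hF : Integrable F (Q.jumpMeasure μ)) :
    Integrable (fun p => F p.swap) (Q.jumpMeasure μ) := by
  rw [hQ.integrable_iff] at hF ⊢
  rw [hQ.summable_swap]
  exact (Equiv.summable_iff _).2 hF

theorem integral_swap (hQ : Q.Regular μ) {F : X × X → ℝ}
    (hF : Integrable F (Q.jumpMeasure μ)) :
    ∫ p, F p.swap ∂Q.jumpMeasure μ = ∫ p, F p ∂Q.jumpMeasure μ := by
  rw [hQ.integral_eq_tsum hF, hQ.integral_eq_tsum (hQ.integrable_swap hF), hQ.summable_swap]
  exact Equiv.tsum_eq (Equiv.prodComm X X)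
    fun p : X × X => μ.real {p.1} * Q.rate p.1 p.2 * F p

/-- Every state has positive mass, so integrability on jumps yields convergence of each row, not
just of almost every row. -/
theorem summable_rate_mul (hQ : Q.Regular μ) {F : X × X → ℝ}
    (hF : Integrable F (Q.jumpMeasure μ)) (x : X) :
    Summable fun y => Q.rate x y * F (x, y) := by
  have h := (hQ.integrable_iff.1 hF).prod_factor x
  refine (h.mul_left (μ.real {x})⁻¹).congr fun y => ?_
  have := (hQ.pos x).ne'
  field_simp

theorem hasSum_jumpSum (hQ : Q.Regular μ) {F : X × X → ℝ}
    (hF : Integrable F (Q.jumpMeasure μ)) :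
    HasSum (fun x => μ.real {x} * Q.jumpSum F x) (∫ p, F p ∂Q.jumpMeasure μ) := by
  rw [hQ.integral_eq_tsum hF]
  have h := hQ.integrable_iff.1 hF
  refine h.hasSum.prod_fiberwise fun x => ?_
  have := (hQ.summable_rate_mul hF x).hasSum.mul_left (μ.real {x})
  simpa only [jumpSum, mul_assoc] using this

theorem integrable_jumpSum (hQ : Q.Regular μ) {F : X × X → ℝ}
    (hF : Integrable F (Q.jumpMeasure μ)) : Integrable (Q.jumpSum F) μ :=
  (integrable_iff_summable_of_countable μ _).2 (hQ.hasSum_jumpSum hF).summable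

theorem integral_jumpSum (hQ : Q.Regular μ) {F : X × X → ℝ}
    (hF : Integrable F (Q.jumpMeasure μ)) :
    ∫ x, Q.jumpSum F x ∂μ = ∫ p, F p ∂Q.jumpMeasure μ := by
  rw [integral_countable (hQ.integrable_jumpSum hF), ← (hQ.hasSum_jumpSum hF).tsum_eq]
  rfl

end Regular

end MarkovGenerator
end

/-! ### Bounded functions, integration by parts and the integrated Ψ₂. -/

noncomputable section

/-- The real function `f` is bounded. -/
def IsBoundedFun {α : Type*} (f : α → ℝ) : Prop := ∃ C, ∀ a, |f a| ≤ C

namespace IsBoundedFun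

variable {α β : Type*} {f g : α → ℝ}

theorem const (c : ℝ) : IsBoundedFun fun _ : α => c := ⟨|c|, fun _ => le_rfl⟩

theorem comp (hf : IsBoundedFun f) (φ : β → α) : IsBoundedFun fun b => f (φ b) :=
  ⟨hf.choose, fun b => hf.choose_spec (φ b)⟩

theorem add (hf : IsBoundedFun f) (hg : IsBoundedFun g) : IsBoundedFun fun a => f a + g a := by
  obtain ⟨C, hC⟩ := hf
  obtain ⟨D, hD⟩ := hg
  exact ⟨C + D, fun a => (abs_add_le _ _).trans (add_le_add (hC a) (hD a))⟩

theorem mul (hf : IsBoundedFun f) (hg : IsBoundedFun g) : IsBoundedFun fun a => f a * g a := by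
  obtain ⟨C, hC⟩ := hf
  obtain ⟨D, hD⟩ := hg
  refine ⟨C * D, fun a => ?_⟩
  rw [abs_mul]
  exact mul_le_mul (hC a) (hD a) (abs_nonneg _) ((abs_nonneg _).trans (hC a))

theorem neg (hf : IsBoundedFun f) : IsBoundedFun fun a => -f a :=
  ⟨hf.choose, fun a => (abs_neg (f a)).le.trans (hf.choose_spec a)⟩

theorem sub (hf : IsBoundedFun f) (hg : IsBoundedFun g) : IsBoundedFun fun a => f a - g a := by
  simpa only [sub_eq_add_neg] using hf.add hg.neg

theorem continuous_comp (hf : IsBoundedFun f) {φ : ℝ → ℝ} (hφ : Continuous φ) :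
    IsBoundedFun fun a => φ (f a) := by
  obtain ⟨C, hC⟩ := hf
  obtain ⟨D, hD⟩ := isCompact_Icc.exists_bound_of_continuousOn (s := Set.Icc (-C) C)
    hφ.continuousOn
  exact ⟨D, fun a => hD _ (abs_le.1 (hC a))⟩

theorem pow (hf : IsBoundedFun f) (n : ℕ) : IsBoundedFun fun a => f a ^ n :=
  hf.continuous_comp (continuous_pow n)

theorem of_mem_Icc {c C : ℝ} (h : ∀ a, f a ∈ Set.Icc c C) : IsBoundedFun f :=
  ⟨max |c| |C|, fun a => abs_le_max_abs_abs (h a).1 (h a).2⟩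

theorem log_of_mem_Icc {c C : ℝ} (hc : 0 < c) (h : ∀ a, f a ∈ Set.Icc c C) :
    IsBoundedFun fun a => Real.log (f a) :=
  of_mem_Icc (c := Real.log c) (C := Real.log C) fun a =>
    ⟨Real.log_le_log hc (h a).1, Real.log_le_log (hc.trans_le (h a).1) (h a).2⟩

theorem integrable [MeasurableSpace α] [DiscreteMeasurableSpace α] {ν : Measure α}
    [Countable α] [IsFiniteMeasure ν] (hf : IsBoundedFun f) : Integrable f ν :=
  Integrable.of_bound .of_discrete hf.choose (.of_forall hf.choose_spec)

theorem mul_integrable [MeasurableSpace α] [DiscreteMeasurableSpace α] {ν : Measure α}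
    [Countable α] (hf : IsBoundedFun f) (hg : Integrable g ν) :
    Integrable (fun a => f a * g a) ν :=
  hg.bdd_mul .of_discrete (.of_forall hf.choose_spec)

end IsBoundedFun

theorem continuous_Upsilon : Continuous MarkovGenerator.Upsilon := by
  unfold MarkovGenerator.Upsilon
  fun_prop

theorem deriv_Upsilon (r : ℝ) : deriv MarkovGenerator.Upsilon r = Real.exp r - 1 := by
  have : HasDerivAt (fun r : ℝ => Real.exp r - r - 1) (Real.exp r - 1) r :=
    ((Real.hasDerivAt_exp r).sub (hasDerivAt_id r)).sub_const 1
  exact this.deriv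

namespace MarkovGenerator

variable {X : Type*} {Q : MarkovGenerator X} [Countable X] [MeasurableSpace X]
  [DiscreteMeasurableSpace X] {μ : Measure X} [IsProbabilityMeasure μ]

theorem abs_jumpSum_le {F : X × X → ℝ} {C : ℝ} (hF : ∀ p, |F p| ≤ C) (x : X) :
    |Q.jumpSum F x| ≤ C * Q.M₁ x := by
  have h : HasSum (fun y => Q.rate x y * C) (C * Q.M₁ x) := by
    rw [mul_comm, ← tsum_rate]
    exact (Q.summable_rate x).hasSum.mul_right C
  refine tsum_of_norm_bounded (f := fun y => Q.rate x y * F (x, y)) h fun y => ?_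
  rw [norm_mul, Real.norm_eq_abs, Real.norm_eq_abs, abs_of_nonneg (Q.rate_nonneg x y)]
  exact mul_le_mul_of_nonneg_left (hF _) (Q.rate_nonneg x y)

namespace Regular

theorem integrable_bounded (hQ : Q.Regular μ) {F : X × X → ℝ} (hF : IsBoundedFun F) :
    Integrable F (Q.jumpMeasure μ) :=
  have := hQ.isFiniteMeasure
  hF.integrable

theorem integrable_jumpSum_fst (hQ : Q.Regular μ) {F : X × X → ℝ} (hF : IsBoundedFun F) :
    Integrable (fun p : X × X => Q.jumpSum F p.1) (Q.jumpMeasure μ) :=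
  hQ.integrable_fst (abs_jumpSum_le hF.choose_spec)

theorem integral_mul_L (hQ : Q.Regular μ) {u v : X → ℝ}
    (h : Integrable (fun p : X × X => v p.1 * (u p.2 - u p.1)) (Q.jumpMeasure μ)) :
    ∫ x, v x * Q.L u x ∂μ = ∫ p, v p.1 * (u p.2 - u p.1) ∂Q.jumpMeasure μ := by
  rw [← hQ.integral_jumpSum h]
  simp only [jumpSum_left_mul, L_eq_jumpSum]

theorem bounded_diff {u : X → ℝ} (hu : IsBoundedFun u) :
    IsBoundedFun fun p : X × X => u p.2 - u p.1 :=
  (hu.comp Prod.snd).sub (hu.comp Prod.fst)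

theorem integrable_mul_L (hQ : Q.Regular μ) {u v : X → ℝ} (hu : IsBoundedFun u)
    (hv : IsBoundedFun v) : Integrable (fun x => v x * Q.L u x) μ := by
  have h := hQ.integrable_jumpSum (hQ.integrable_bounded ((hv.comp Prod.fst).mul (bounded_diff hu)))
  refine h.congr (.of_forall fun x => ?_)
  simp only [jumpSum_left_mul, L_eq_jumpSum]

/-- Integration by parts: average the integrand on jumps with its image under reversal of the jump.
-/
theorem integral_mul_L_eq_neg (hQ : Q.Regular μ) {u v : X → ℝ} (hu : IsBoundedFun u)
    (hv : IsBoundedFun v) :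
    ∫ x, v x * Q.L u x ∂μ =
      -((1 / 2) * ∫ p, (v p.2 - v p.1) * (u p.2 - u p.1) ∂Q.jumpMeasure μ) := by
  have h := hQ.integrable_bounded ((hv.comp Prod.fst).mul (bounded_diff hu))
  rw [hQ.integral_mul_L h]
  have h1 := hQ.integral_swap h
  have h2 := integral_add h (hQ.integrable_swap h)
  have h3 : ∫ p, (v p.2 - v p.1) * (u p.2 - u p.1) ∂Q.jumpMeasure μ =
      -∫ p : X × X, (v p.1 * (u p.2 - u p.1) +
        v p.swap.1 * (u p.swap.2 - u p.swap.1)) ∂Q.jumpMeasure μ := by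
    rw [← integral_neg]
    refine integral_congr_ae (.of_forall fun p => ?_)
    simp only [Prod.fst_swap, Prod.snd_swap]
    ring
  linarith

theorem integral_L (hQ : Q.Regular μ) {u : X → ℝ} (hu : IsBoundedFun u) :
    ∫ x, Q.L u x ∂μ = 0 := by
  simpa using hQ.integral_mul_L_eq_neg hu (IsBoundedFun.const 1)

theorem integrable_snd (hQ : Q.Regular μ) {g : X → ℝ}
    (hg : Integrable (fun p : X × X => g p.1) (Q.jumpMeasure μ)) :
    Integrable (fun p : X × X => g p.2) (Q.jumpMeasure μ) := by
  have h := hQ.integrable_swap (F := fun p : X × X => g p.1) hg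
  exact h

/-- Expand and reverse the jumps in the terms where ψ or ℓ sits at the end point. Only values of ψ
and ℓ at the starting point survive, and ℓ is counted twice. -/
theorem integral_carre_exchange (hQ : Q.Regular μ) {u ψ ℓ : X → ℝ} (hu : IsBoundedFun u)
    (hψ : Integrable (fun p : X × X => ψ p.1) (Q.jumpMeasure μ))
    (hℓ : Integrable (fun p : X × X => ℓ p.1) (Q.jumpMeasure μ)) :
    ∫ p, (u p.1 * (ψ p.2 - ψ p.1) - (u p.2 - u p.1) * (ℓ p.2 - ℓ p.1)) ∂Q.jumpMeasure μ =
      ∫ p, (u p.2 - u p.1) * (ψ p.1 + 2 * ℓ p.1) ∂Q.jumpMeasure μ := by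
  have hu1 := hu.comp (Prod.fst : X × X → X)
  have hu2 := hu.comp (Prod.snd : X × X → X)
  have hψ2 : Integrable (fun p : X × X => ψ p.2) (Q.jumpMeasure μ) := hQ.integrable_snd hψ
  have hℓ2 : Integrable (fun p : X × X => ℓ p.2) (Q.jumpMeasure μ) := hQ.integrable_snd hℓ
  have a11 := hu1.mul_integrable hψ
  have a12 := hu1.mul_integrable hψ2
  have a21 := hu2.mul_integrable hψ
  have b11 := hu1.mul_integrable hℓ
  have b12 := hu1.mul_integrable hℓ2
  have b21 := hu2.mul_integrable hℓ
  have b22 := hu2.mul_integrable hℓ2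
  have ea := hQ.integral_swap a12
  have eb := hQ.integral_swap b12
  have eb' := hQ.integral_swap b22
  simp only [Prod.fst_swap, Prod.snd_swap] at ea eb eb'
  have e1 : ∀ p : X × X, u p.1 * (ψ p.2 - ψ p.1) - (u p.2 - u p.1) * (ℓ p.2 - ℓ p.1) =
      (u p.1 * ψ p.2 - u p.1 * ψ p.1) - ((u p.2 * ℓ p.2 - u p.2 * ℓ p.1) -
        (u p.1 * ℓ p.2 - u p.1 * ℓ p.1)) := fun p => by ring
  have e2 : ∀ p : X × X, (u p.2 - u p.1) * (ψ p.1 + 2 * ℓ p.1) =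
      (u p.2 * ψ p.1 - u p.1 * ψ p.1) + 2 * (u p.2 * ℓ p.1 - u p.1 * ℓ p.1) := fun p => by ring
  rw [integral_congr_ae (.of_forall e1), integral_congr_ae (.of_forall e2),
    integral_sub (a12.sub' a11) ((b22.sub' b21).sub' (b12.sub' b11)), integral_sub a12 a11,
    integral_sub (b22.sub' b21) (b12.sub' b11), integral_sub b22 b21, integral_sub b12 b11,
    integral_add (a21.sub' a11) ((b21.sub' b11).const_mul 2), integral_sub a21 a11,
    integral_const_mul, integral_sub b21 b11]
  linarith

theorem integrable_Psi_fst (hQ : Q.Regular μ) {w : X → ℝ} (hw : IsBoundedFun w) :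
    Integrable (fun p : X × X => Q.Psi Upsilon w p.1) (Q.jumpMeasure μ) := by
  refine (hQ.integrable_jumpSum_fst
    ((bounded_diff hw).continuous_comp continuous_Upsilon)).congr (.of_forall fun p => ?_)
  exact (Q.Psi_eq_jumpSum (H := Upsilon) (by simp [Upsilon]) w p.1).symm

theorem integrable_L_fst (hQ : Q.Regular μ) {w : X → ℝ} (hw : IsBoundedFun w) :
    Integrable (fun p : X × X => Q.L w p.1) (Q.jumpMeasure μ) := by
  refine (hQ.integrable_jumpSum_fst (bounded_diff hw)).congr (.of_forall fun p => ?_)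
  exact (Q.L_eq_jumpSum w p.1).symm

/-- The weight e^w absorbs Υ': e^{w(x)}(e^{w(y)-w(x)} - 1) = e^{w(y)} - e^{w(x)}. -/
theorem exp_mul_Psi₂_eq_jumpSum (hQ : Q.Regular μ) {w : X → ℝ} (hw : IsBoundedFun w) :
    ∃ G : X × X → ℝ, Integrable G (Q.jumpMeasure μ) ∧
      (∀ x, 2 * (Real.exp (w x) * Q.Psi₂ Upsilon w x) = Q.jumpSum G x) ∧
      ∀ p, G p = Real.exp (w p.1) * (Q.Psi Upsilon w p.2 - Q.Psi Upsilon w p.1) -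
        (Real.exp (w p.2) - Real.exp (w p.1)) * (Q.L w p.2 - Q.L w p.1) := by
  have hψi := hQ.integrable_Psi_fst hw
  have hℓi := hQ.integrable_L_fst hw
  let F₁ : X × X → ℝ := fun p => Q.Psi Upsilon w p.2 - Q.Psi Upsilon w p.1
  let F₂ : X × X → ℝ := fun p => deriv Upsilon (w p.2 - w p.1) * (Q.L w p.2 - Q.L w p.1)
  have hF1 : Integrable F₁ (Q.jumpMeasure μ) := (hQ.integrable_snd hψi).sub' hψi
  have hb : IsBoundedFun fun p : X × X => deriv Upsilon (w p.2 - w p.1) := by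
    simp only [deriv_Upsilon]
    exact ((bounded_diff hw).continuous_comp Real.continuous_exp).sub (IsBoundedFun.const 1)
  have hF2 : Integrable F₂ (Q.jumpMeasure μ) :=
    hb.mul_integrable ((hQ.integrable_snd hℓi).sub' hℓi)
  refine ⟨fun p => Real.exp (w p.1) * (F₁ p - F₂ p),
    ((hw.continuous_comp Real.continuous_exp).comp Prod.fst).mul_integrable (hF1.sub' hF2),
    fun x => ?_, fun p => ?_⟩
  · rw [Q.jumpSum_left_mul (fun x => Real.exp (w x)) (fun p => F₁ p - F₂ p),
      Q.jumpSum_sub (hQ.summable_rate_mul hF1 x) (hQ.summable_rate_mul hF2 x),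
      Psi₂, L_eq_jumpSum, B_eq_jumpSum]
    ring
  · simp only [F₁, F₂, deriv_Upsilon, Real.exp_sub]
    have := (Real.exp_pos (w p.1)).ne'
    field_simp

theorem integrable_exp_mul_Psi₂ (hQ : Q.Regular μ) {w : X → ℝ} (hw : IsBoundedFun w) :
    Integrable (fun x => 2 * (Real.exp (w x) * Q.Psi₂ Upsilon w x)) μ := by
  obtain ⟨G, hG, hGx, -⟩ := hQ.exp_mul_Psi₂_eq_jumpSum hw
  simp only [hGx]
  exact hQ.integrable_jumpSum hG

/-- With u = e^w, this is formally minus the derivative of the Fisher information along the heat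
flow, brought to the form in which the first variation of `fisher` appears. -/
theorem integral_exp_mul_Psi₂ (hQ : Q.Regular μ) {w : X → ℝ} (hw : IsBoundedFun w) :
    ∫ x, 2 * (Real.exp (w x) * Q.Psi₂ Upsilon w x) ∂μ =
      ∫ p, (Real.exp (w p.2) - Real.exp (w p.1)) *
        (Q.Psi Upsilon w p.1 + 2 * Q.L w p.1) ∂Q.jumpMeasure μ := by
  obtain ⟨G, hG, hGx, hGp⟩ := hQ.exp_mul_Psi₂_eq_jumpSum hw
  simp only [hGx]
  rw [hQ.integral_jumpSum hG, integral_congr_ae (.of_forall hGp)]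
  exact hQ.integral_carre_exchange (hw.continuous_comp Real.continuous_exp)
    (hQ.integrable_Psi_fst hw) (hQ.integrable_L_fst hw)

end Regular

end MarkovGenerator
end

/-! ### Entropy, Fisher information and their convexity. -/

noncomputable section

/-- The function is a log(a/b) + b log(b/a), a sum of two jointly convex relative entropies. Each
tangent inequality is log r ≥ 1 - 1/r for a quotient of ratios. -/
theorem sub_mul_log_sub_log_convex {a b a' b' : ℝ} (ha : 0 < a) (hb : 0 < b) (ha' : 0 < a')
    (hb' : 0 < b') :
    (b - a) * (Real.log b - Real.log a) +
      ((Real.log a - Real.log b + 1 - b / a) * (a' - a) +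
        (Real.log b - Real.log a + 1 - a / b) * (b' - b)) ≤
      (b' - a') * (Real.log b' - Real.log a') := by
  have h1 := Real.one_sub_inv_le_log_of_pos (x := (a' / b') / (a / b)) (by positivity)
  have h2 := Real.one_sub_inv_le_log_of_pos (x := (b' / a') / (b / a)) (by positivity)
  rw [Real.log_div (by positivity) (by positivity), Real.log_div ha'.ne' hb'.ne',
    Real.log_div ha.ne' hb.ne'] at h1
  rw [Real.log_div (by positivity) (by positivity), Real.log_div hb'.ne' ha'.ne',
    Real.log_div hb.ne' ha.ne'] at h2
  have h3 := mul_le_mul_of_nonneg_left h1 ha'.le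
  have h4 := mul_le_mul_of_nonneg_left h2 hb'.le
  have e1 : a' * (1 - (a' / b' / (a / b))⁻¹) = a' - a / b * b' := by
    field_simp
  have e2 : b' * (1 - (b' / a' / (b / a))⁻¹) = b' - b / a * a' := by
    field_simp
  have e3 : b / a * a = b := by field_simp
  have e4 : a / b * b = a := by field_simp
  rw [e1] at h3
  rw [e2] at h4
  linear_combination h3 + h4 + e3 + e4

theorem sub_mul_log_sub_log_le {a b c : ℝ} (hc : 0 < c) (ha : c ≤ a) (hb : c ≤ b) :
    (a - b) * (Real.log a - Real.log b) ≤ (a - b) ^ 2 / c := by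
  wlog h : b ≤ a generalizing a b
  · have := this hb ha (le_of_not_ge h)
    linear_combination this
  have ha0 := hc.trans_le ha
  have hb0 := hc.trans_le hb
  have h1 : Real.log a - Real.log b ≤ (a - b) / b := by
    rw [← Real.log_div ha0.ne' hb0.ne']
    have := Real.log_le_sub_one_of_pos (div_pos ha0 hb0)
    rwa [sub_div, div_self hb0.ne']
  have h2 : (a - b) / b ≤ (a - b) / c := div_le_div_of_nonneg_left (by linarith) hc hb
  calc (a - b) * (Real.log a - Real.log b) ≤ (a - b) * ((a - b) / c) :=
        mul_le_mul_of_nonneg_left (h1.trans h2) (by linarith)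
    _ = _ := by ring

theorem le_sub_mul_log_sub_log {a b C : ℝ} (ha : 0 < a) (hb : 0 < b) (haC : a ≤ C) (hbC : b ≤ C) :
    (a - b) ^ 2 / C ≤ (a - b) * (Real.log a - Real.log b) := by
  wlog h : b ≤ a generalizing a b
  · have := this hb ha hbC haC (le_of_not_ge h)
    linear_combination this
  have h1 : (a - b) / a ≤ Real.log a - Real.log b := by
    rw [← Real.log_div ha.ne' hb.ne']
    have := Real.one_sub_inv_le_log_of_pos (div_pos ha hb)
    rwa [inv_div, ← div_self ha.ne', ← sub_div] at this
  have h2 : (a - b) / C ≤ (a - b) / a := div_le_div_of_nonneg_left (by linarith) ha haC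
  calc (a - b) ^ 2 / C = (a - b) * ((a - b) / C) := by ring
    _ ≤ _ := mul_le_mul_of_nonneg_left (h2.trans h1) (by linarith)

theorem mul_log_sub_le {a b : ℝ} (ha : 0 < a) (hb : 0 < b) :
    a * Real.log a - b * Real.log b ≤ (Real.log a + 1) * (a - b) := by
  have := Real.one_sub_inv_le_log_of_pos (div_pos hb ha)
  rw [Real.log_div hb.ne' ha.ne', inv_div] at this
  have h := mul_le_mul_of_nonneg_left this hb.le
  have e : b * (1 - a / b) = b - a := by field_simp
  rw [e] at h
  linarith

namespace MarkovGenerator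

variable {X : Type*} (Q : MarkovGenerator X) [MeasurableSpace X]

/-- The Fisher information `½ ∫ (u(y) - u(x)) (log u(y) - log u(x))` of the function `u`. -/
def fisher (μ : Measure X) (u : X → ℝ) : ℝ :=
  (1 / 2) * ∫ p, (u p.2 - u p.1) * (Real.log (u p.2) - Real.log (u p.1)) ∂Q.jumpMeasure μ

/-- The Dirichlet energy `½ ∫ (u(y) - u(x))²`. -/
def energy (μ : Measure X) (u : X → ℝ) : ℝ :=
  (1 / 2) * ∫ p, (u p.2 - u p.1) ^ 2 ∂Q.jumpMeasure μ

/-- The integral `∫ u log u`. -/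
def entropy (μ : Measure X) (u : X → ℝ) : ℝ := ∫ x, u x * Real.log (u x) ∂μ

variable {Q}

theorem energy_nonneg (μ : Measure X) (u : X → ℝ) : 0 ≤ Q.energy μ u :=
  mul_nonneg (by norm_num) (integral_nonneg fun _ => sq_nonneg _)

variable [Countable X] [DiscreteMeasurableSpace X] {μ : Measure X} [IsProbabilityMeasure μ]

theorem fisher_nonneg {u : X → ℝ} (hu : ∀ x, 0 < u x) : 0 ≤ Q.fisher μ u := by
  refine mul_nonneg (by norm_num) (integral_nonneg fun p => ?_)
  have h := le_sub_mul_log_sub_log (hu p.2) (hu p.1) (le_max_left _ _) (le_max_right _ _)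
  have : 0 < max (u p.2) (u p.1) := lt_max_of_lt_left (hu _)
  exact le_trans (by positivity) h

namespace Regular

theorem integral_mul_L_log (hQ : Q.Regular μ) {u : X → ℝ} (hu : IsBoundedFun u)
    (hlog : IsBoundedFun fun x => Real.log (u x)) :
    ∫ x, u x * Q.L (fun x => Real.log (u x)) x ∂μ = -Q.fisher μ u :=
  hQ.integral_mul_L_eq_neg hlog hu

theorem integral_log_mul_L (hQ : Q.Regular μ) {u : X → ℝ} (hu : IsBoundedFun u)
    (hlog : IsBoundedFun fun x => Real.log (u x)) :
    ∫ x, Real.log (u x) * Q.L u x ∂μ = -Q.fisher μ u := by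
  rw [hQ.integral_mul_L_eq_neg hu hlog, fisher]
  simp only [mul_comm]

theorem integrable_L (hQ : Q.Regular μ) {u : X → ℝ} (hu : IsBoundedFun u) :
    Integrable (Q.L u) μ := by
  have h := hQ.integrable_mul_L hu (IsBoundedFun.const 1)
  simpa only [one_mul] using h

/-- On each jump, u(x) Υ(log u(y) - log u(x)) = u(y) - u(x) - u(x)(log u(y) - log u(x)). Integrated,
it shows that ∫ u Ψ_Υ(log u) is the Fisher information. -/
theorem mul_Psi_log (hQ : Q.Regular μ) {u : X → ℝ} (hu : IsBoundedFun u) (hpos : ∀ x, 0 < u x)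
    (hlog : IsBoundedFun fun x => Real.log (u x)) (x : X) :
    u x * Q.Psi Upsilon (fun x => Real.log (u x)) x =
      Q.L u x - u x * Q.L (fun x => Real.log (u x)) x := by
  let F : X × X → ℝ := fun p => u p.2 - u p.1
  let G : X × X → ℝ := fun p => u p.1 * (Real.log (u p.2) - Real.log (u p.1))
  have h1 := hQ.summable_rate_mul (F := F) (hQ.integrable_bounded (bounded_diff hu)) x
  have h2 := hQ.summable_rate_mul (F := G) (hQ.integrable_bounded
    ((hu.comp Prod.fst).mul (bounded_diff hlog))) x
  have h3 := Q.jumpSum_left_mul u (fun p => Real.log (u p.2) - Real.log (u p.1)) x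
  rw [Q.Psi_eq_jumpSum (by simp [Upsilon]), L_eq_jumpSum, L_eq_jumpSum, ← h3,
    ← Q.jumpSum_sub h1 h2, ← Q.jumpSum_left_mul u]
  congr 1
  ext p
  simp only [Upsilon, F, G]
  rw [Real.exp_sub, Real.exp_log (hpos _), Real.exp_log (hpos _)]
  have := (hpos p.1).ne'
  field_simp
  ring

/-- The tangent inequality integrated over jumps. The two partial derivatives are exchanged by
reversal, so their equal contributions cancel the factor 1/2. -/
theorem fisher_add_le (hQ : Q.Regular μ) {f u : X → ℝ} {c C : ℝ} (hc : 0 < c)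
    (hf : ∀ x, f x ∈ Set.Icc c C) (hu : ∀ x, u x ∈ Set.Icc c C) :
    Q.fisher μ u + ∫ p : X × X, (Real.log (u p.1) - Real.log (u p.2) + 1 - u p.2 / u p.1) *
      (f p.1 - u p.1) ∂Q.jumpMeasure μ ≤ Q.fisher μ f := by
  have hu0 x : 0 < u x := hc.trans_le (hu x).1
  have hf0 x : 0 < f x := hc.trans_le (hf x).1
  have hub := IsBoundedFun.of_mem_Icc hu
  have hfb := IsBoundedFun.of_mem_Icc hf
  have hul := IsBoundedFun.log_of_mem_Icc hc hu
  have hfl := IsBoundedFun.log_of_mem_Icc hc hf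
  have hui : IsBoundedFun fun x => (u x)⁻¹ :=
    IsBoundedFun.of_mem_Icc (c := C⁻¹) (C := c⁻¹) fun x =>
      ⟨inv_anti₀ (hu0 x) (hu x).2, inv_anti₀ hc (hu x).1⟩
  set G : X × X → ℝ := fun p =>
    (Real.log (u p.1) - Real.log (u p.2) + 1 - u p.2 / u p.1) * (f p.1 - u p.1) with hG
  have hGb : IsBoundedFun G := by
    simp only [hG, div_eq_mul_inv]
    exact ((((hul.comp Prod.fst).sub (hul.comp Prod.snd)).add (IsBoundedFun.const 1)).sub
      ((hub.comp Prod.snd).mul (hui.comp Prod.fst))).mul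
        ((hfb.comp Prod.fst).sub (hub.comp Prod.fst))
  have hGi := hQ.integrable_bounded hGb
  have hGs := hQ.integrable_swap hGi
  have hfi := hQ.integrable_bounded ((bounded_diff hfb).mul (bounded_diff hfl))
  have hui' := hQ.integrable_bounded ((bounded_diff hub).mul (bounded_diff hul))
  have hGa : Integrable (fun p => G p + G p.swap) (Q.jumpMeasure μ) := hGi.add hGs
  have h := integral_mono (hui'.add hGa) hfi fun p =>
    sub_mul_log_sub_log_convex (hu0 p.1) (hu0 p.2) (hf0 p.1) (hf0 p.2)
  rw [integral_add' hui' hGa, integral_add hGi hGs, hQ.integral_swap hGi] at h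
  unfold fisher
  linarith

end Regular

end MarkovGenerator
end

/-! ### The resolvent and the estimates for one implicit Euler step. -/

noncomputable section

namespace MarkovGenerator

variable {X : Type*} {Q : MarkovGenerator X}

/-- The monotone iteration that solves `u - ε L u = f`. -/
def resolventStep (Q : MarkovGenerator X) (ε : ℝ) (f v : X → ℝ) (x : X) : ℝ :=
  (f x + ε * ∑' y, Q.rate x y * v y) / (1 + ε * Q.M₁ x)

theorem summable_rate_mul_of_mem_Icc {c C : ℝ} {v : X → ℝ} (hv : ∀ x, v x ∈ Set.Icc c C) (x : X) :
    Summable fun y => Q.rate x y * v y := by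
  obtain ⟨D, hD⟩ := IsBoundedFun.of_mem_Icc hv
  refine ((Q.summable_rate x).mul_right D).of_norm_bounded fun y => ?_
  rw [norm_mul, Real.norm_eq_abs, Real.norm_eq_abs, abs_of_nonneg (Q.rate_nonneg x y)]
  exact mul_le_mul_of_nonneg_left (hD y) (Q.rate_nonneg x y)

theorem resolventStep_mono {ε : ℝ} (hε : 0 ≤ ε) {f v v' : X → ℝ} {c C : ℝ}
    (hv : ∀ x, v x ∈ Set.Icc c C) (hv' : ∀ x, v' x ∈ Set.Icc c C) (h : ∀ x, v x ≤ v' x) (x : X) :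
    Q.resolventStep ε f v x ≤ Q.resolventStep ε f v' x := by
  unfold resolventStep
  have h0 : 0 ≤ 1 + ε * Q.M₁ x := by have := mul_nonneg hε (Q.M₁_nonneg x); linarith
  refine div_le_div_of_nonneg_right ?_ h0
  have := (summable_rate_mul_of_mem_Icc (Q := Q) hv x).tsum_le_tsum
    (fun y => mul_le_mul_of_nonneg_left (h y) (Q.rate_nonneg x y))
    (summable_rate_mul_of_mem_Icc hv' x)
  have := mul_le_mul_of_nonneg_left this hε
  linarith

/-- Maximum principle: the step is a weighted average of `f x` and the values of `v`, as the rates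
out of `x` sum to `M₁ x`. -/
theorem resolventStep_mem_Icc {ε : ℝ} (hε : 0 ≤ ε) {f v : X → ℝ} {c C : ℝ}
    (hf : ∀ x, f x ∈ Set.Icc c C) (hv : ∀ x, v x ∈ Set.Icc c C) (x : X) :
    Q.resolventStep ε f v x ∈ Set.Icc c C := by
  have h0 : 0 < 1 + ε * Q.M₁ x := by have := mul_nonneg hε (Q.M₁_nonneg x); linarith
  have hs := summable_rate_mul_of_mem_Icc (Q := Q) hv x
  have h1 := ((Q.summable_rate x).mul_right c).tsum_le_tsum
    (fun y => mul_le_mul_of_nonneg_left (hv y).1 (Q.rate_nonneg x y)) hs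
  have h2 := hs.tsum_le_tsum
    (fun y => mul_le_mul_of_nonneg_left (hv y).2 (Q.rate_nonneg x y))
    ((Q.summable_rate x).mul_right C)
  rw [tsum_mul_right, tsum_rate] at h1 h2
  have h1' := mul_le_mul_of_nonneg_left h1 hε
  have h2' := mul_le_mul_of_nonneg_left h2 hε
  unfold resolventStep
  rw [Set.mem_Icc, le_div_iff₀ h0, div_le_iff₀ h0]
  constructor
  · linarith [(hf x).1]
  · linarith [(hf x).2]

/-- The iterates started from the lower bound `c` increase and stay below `C`; their limit is a
fixed point. No bound on `M₁` is needed, since dominated convergence is applied in one row at a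
time. -/
theorem exists_resolvent {ε : ℝ} (hε : 0 ≤ ε) {f : X → ℝ} {c C : ℝ}
    (hf : ∀ x, f x ∈ Set.Icc c C) :
    ∃ u : X → ℝ, (∀ x, u x ∈ Set.Icc c C) ∧ ∀ x, u x - ε * Q.L u x = f x := by
  rcases isEmpty_or_nonempty X with hX | ⟨⟨x₀⟩⟩
  · exact ⟨f, hf, fun x => hX.elim x⟩
  have hcC : c ≤ C := (hf x₀).1.trans (hf x₀).2
  let v : ℕ → X → ℝ := fun m => (Q.resolventStep ε f)^[m] fun _ => c
  have hv0 : v 0 = fun _ => c := rfl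
  have hvs (m : ℕ) : v (m + 1) = Q.resolventStep ε f (v m) :=
    Function.iterate_succ_apply' _ _ _
  have hmem (m : ℕ) : ∀ x, v m x ∈ Set.Icc c C := by
    induction m with
    | zero => intro x; rw [hv0]; exact ⟨le_rfl, hcC⟩
    | succ m ih => rw [hvs]; exact resolventStep_mem_Icc hε hf ih
  have hstep (m : ℕ) : ∀ x, v m x ≤ v (m + 1) x := by
    induction m with
    | zero => intro x; rw [hv0]; exact (hmem 1 x).1
    | succ m ih =>
      intro x
      rw [hvs (m + 1)]
      nth_rw 1 [hvs m]
      exact resolventStep_mono hε (hmem m) (hmem (m + 1)) ih x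
  have hbdd (x : X) : BddAbove (Set.range fun m => v m x) :=
    ⟨C, by rintro _ ⟨m, rfl⟩; exact (hmem m x).2⟩
  let u : X → ℝ := fun x => ⨆ m, v m x
  have hlim (x : X) : Filter.Tendsto (fun m => v m x) Filter.atTop (nhds (u x)) :=
    tendsto_atTop_ciSup (monotone_nat_of_le_succ fun m => hstep m x) (hbdd x)
  have hu (x : X) : u x ∈ Set.Icc c C :=
    isClosed_Icc.mem_of_tendsto (hlim x) (.of_forall fun m => hmem m x)
  refine ⟨u, hu, fun x => ?_⟩
  have h0 : 0 < 1 + ε * Q.M₁ x := by have := mul_nonneg hε (Q.M₁_nonneg x); linarith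
  have hsum : Filter.Tendsto (fun m => ∑' y, Q.rate x y * v m y) Filter.atTop
      (nhds (∑' y, Q.rate x y * u y)) := by
    refine tendsto_tsum_of_dominated_convergence
      ((Q.summable_rate x).mul_right (max |c| |C|)) (fun y => (hlim y).const_mul _)
      (.of_forall fun m y => ?_)
    rw [norm_mul, Real.norm_eq_abs, Real.norm_eq_abs, abs_of_nonneg (Q.rate_nonneg x y)]
    exact mul_le_mul_of_nonneg_left (abs_le_max_abs_abs (hmem m y).1 (hmem m y).2)
      (Q.rate_nonneg x y)
  have hfix : u x = Q.resolventStep ε f u x := by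
    refine tendsto_nhds_unique ((hlim x).comp (Filter.tendsto_add_atTop_nat 1)) ?_
    have := ((hsum.const_mul ε).const_add (f x)).div_const (1 + ε * Q.M₁ x)
    refine this.congr fun m => ?_
    simp only [Function.comp, hvs]
    rfl
  have hL : Q.L u x = ∑' y, Q.rate x y * u y - Q.M₁ x * u x := by
    rw [L_eq_jumpSum, jumpSum, ← tsum_rate, ← tsum_mul_right,
      ← (summable_rate_mul_of_mem_Icc hu x).tsum_sub ((Q.summable_rate x).mul_right (u x))]
    exact tsum_congr fun y => by ring
  rw [resolventStep, eq_div_iff h0.ne'] at hfix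
  rw [hL]
  linarith

variable [Countable X] [MeasurableSpace X] [DiscreteMeasurableSpace X]
  {μ : Measure X} [IsProbabilityMeasure μ]

namespace Regular

/-- Identifies the first variation of the Fisher information with the factor occurring in
`integral_exp_mul_Psi₂`. -/
theorem jumpSum_log_derivative (hQ : Q.Regular μ) {u : X → ℝ} (hu : ∀ x, 0 < u x)
    (hlog : IsBoundedFun fun x => Real.log (u x)) (x : X) :
    Q.jumpSum (fun p => Real.log (u p.1) - Real.log (u p.2) + 1 - u p.2 / u p.1) x =
      -(Q.Psi Upsilon (fun x => Real.log (u x)) x + 2 * Q.L (fun x => Real.log (u x)) x) := by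
  let F : X × X → ℝ := fun p => -2 * (Real.log (u p.2) - Real.log (u p.1))
  let G : X × X → ℝ := fun p => Upsilon (Real.log (u p.2) - Real.log (u p.1))
  have h1 := hQ.summable_rate_mul (F := F) (hQ.integrable_bounded
    ((IsBoundedFun.const (-2)).mul (bounded_diff hlog))) x
  have h2 := hQ.summable_rate_mul (F := G) (hQ.integrable_bounded
    ((bounded_diff hlog).continuous_comp continuous_Upsilon)) x
  have h3 := Q.jumpSum_left_mul (fun _ => -2) (fun p => Real.log (u p.2) - Real.log (u p.1)) x
  have h4 : Q.jumpSum (fun p => Real.log (u p.1) - Real.log (u p.2) + 1 - u p.2 / u p.1) x =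
      Q.jumpSum (fun p => F p - G p) x := by
    congr 1
    ext p
    simp only [F, G, Upsilon]
    rw [Real.exp_sub, Real.exp_log (hu _), Real.exp_log (hu _)]
    ring
  rw [h4, Q.jumpSum_sub h1 h2, Q.Psi_eq_jumpSum (by simp [Upsilon]), L_eq_jumpSum]
  simp only [F, G]
  rw [h3]
  ring

/-- Insert f - u = -εLu in the tangent inequality at u. Convexity makes the implicit step lose
nothing against the continuous flow. -/
theorem fisher_resolvent_add_le (hQ : Q.Regular μ) {f u : X → ℝ} {c C ε : ℝ} (hc : 0 < c)
    (hf : ∀ x, f x ∈ Set.Icc c C) (hu : ∀ x, u x ∈ Set.Icc c C)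
    (heq : ∀ x, u x - ε * Q.L u x = f x) :
    Q.fisher μ u + ε * ∫ x, 2 * (u x * Q.Psi₂ Upsilon (fun x => Real.log (u x)) x) ∂μ ≤
      Q.fisher μ f := by
  have hu0 x : 0 < u x := hc.trans_le (hu x).1
  have hub := IsBoundedFun.of_mem_Icc hu
  have hfb := IsBoundedFun.of_mem_Icc hf
  have hul := IsBoundedFun.log_of_mem_Icc hc hu
  refine le_trans (le_of_eq ?_) (hQ.fisher_add_le hc hf hu)
  congr 1
  have hP := hQ.integral_exp_mul_Psi₂ hul
  simp only [Real.exp_log (hu0 _)] at hP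
  let G : X × X → ℝ := fun p => (u p.2 - u p.1) *
    (Q.Psi Upsilon (fun x => Real.log (u x)) p.1 + 2 * Q.L (fun x => Real.log (u x)) p.1)
  have hG : Integrable G (Q.jumpMeasure μ) := (bounded_diff hub).mul_integrable
    ((hQ.integrable_Psi_fst hul).add ((hQ.integrable_L_fst hul).const_mul 2))
  let F : X × X → ℝ := fun p => (f p.1 - u p.1) *
    (Real.log (u p.1) - Real.log (u p.2) + 1 - u p.2 / u p.1)
  have hF : Integrable F (Q.jumpMeasure μ) := by
    refine hQ.integrable_bounded (((hfb.comp Prod.fst).sub (hub.comp Prod.fst)).mul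
      ((((hul.comp Prod.fst).sub (hul.comp Prod.snd)).add (IsBoundedFun.const 1)).sub ?_))
    refine ((bounded_diff hul).continuous_comp Real.continuous_exp).comp id |>.imp fun D hD p => ?_
    have := hD p
    simpa only [id, Real.exp_sub, Real.exp_log (hu0 _)] using this
  have e1 : ∫ p : X × X, (Real.log (u p.1) - Real.log (u p.2) + 1 - u p.2 / u p.1) *
      (f p.1 - u p.1) ∂Q.jumpMeasure μ = ∫ p, F p ∂Q.jumpMeasure μ := by
    simp only [F, mul_comm]
  rw [hP, e1, ← hQ.integral_jumpSum hF, ← hQ.integral_jumpSum hG, ← integral_const_mul]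
  refine integral_congr_ae (.of_forall fun x => ?_)
  have h1 := Q.jumpSum_left_mul (fun x => f x - u x)
    (fun p => Real.log (u p.1) - Real.log (u p.2) + 1 - u p.2 / u p.1) x
  have h2 := Q.jumpSum_left_mul (fun x => Q.Psi Upsilon (fun x => Real.log (u x)) x +
    2 * Q.L (fun x => Real.log (u x)) x) (fun p => u p.2 - u p.1) x
  simp only [F, G]
  rw [h1, hQ.jumpSum_log_derivative hu0 hul, ← heq]
  simp only [mul_comm (u _ - u _)]
  rw [h2, ← L_eq_jumpSum]
  ring

theorem fisher_resolvent_step (hQ : Q.Regular μ) {κ n : ℝ} (hn : 0 < n)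
    (hCD : Q.CDUpsilonDim κ n) {f u : X → ℝ} {c C ε : ℝ} (hc : 0 < c) (hε : 0 ≤ ε)
    (hf : ∀ x, f x ∈ Set.Icc c C) (hu : ∀ x, u x ∈ Set.Icc c C)
    (heq : ∀ x, u x - ε * Q.L u x = f x) (hint : ∫ x, u x ∂μ = 1) :
    Q.fisher μ u + 2 * ε * (κ * Q.fisher μ u + Q.fisher μ u ^ 2 / n) ≤ Q.fisher μ f := by
  have hu0 x : 0 < u x := hc.trans_le (hu x).1
  have hub := IsBoundedFun.of_mem_Icc hu
  have hul := IsBoundedFun.log_of_mem_Icc hc hu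
  refine le_trans ?_ (hQ.fisher_resolvent_add_le hc hf hu heq)
  set s := Q.fisher μ u with hs
  have hs0 : 0 ≤ s := fisher_nonneg hu0
  have hPi := hQ.integrable_exp_mul_Psi₂ hul
  simp only [Real.exp_log (hu0 _)] at hPi
  have hLi := hQ.integrable_L hub
  have hWi := hQ.integrable_mul_L hul hub
  have hui : Integrable u μ := hub.integrable
  have hlow : ∀ x, 2 * κ * Q.L u x - (2 * κ + 4 * s / n) *
      (u x * Q.L (fun x => Real.log (u x)) x) - 2 * s ^ 2 / n * u x ≤
      2 * (u x * Q.Psi₂ Upsilon (fun x => Real.log (u x)) x) := by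
    intro x
    have h1 := hCD (fun x => Real.log (u x)) hul x
    have h2 := hQ.mul_Psi_log hub hu0 hul x
    -- The tangent to r² at s = I(u) replaces Jensen's inequality: it is affine in r = -L log u, and
    -- ∫ u r dμ = s. For r < 0 it is nonpositive, which matches the truncation.
    have h3 : (2 * s * (-Q.L (fun x => Real.log (u x)) x) - s ^ 2) / n ≤
        (Set.Ici 0).indicator (fun r => r ^ 2 / n) (-Q.L (fun x => Real.log (u x)) x) := by
      generalize -Q.L (fun x => Real.log (u x)) x = r
      by_cases hr : 0 ≤ r
      · rw [Set.indicator_of_mem (by exact hr)]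
        refine div_le_div_of_nonneg_right ?_ hn.le
        nlinarith [sq_nonneg (r - s)]
      · rw [Set.indicator_of_notMem (by simpa using hr)]
        refine div_nonpos_of_nonpos_of_nonneg ?_ hn.le
        nlinarith [mul_nonneg hs0 (neg_nonneg.2 (not_le.1 hr).le)]
    have h4 := mul_le_mul_of_nonneg_left ((add_le_add_right h3 _).trans h1) (hu0 x).le
    have h5 : u x * (κ * Q.Psi Upsilon (fun x => Real.log (u x)) x +
        (2 * s * (-Q.L (fun x => Real.log (u x)) x) - s ^ 2) / n) =
        κ * (u x * Q.Psi Upsilon (fun x => Real.log (u x)) x) -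
        (2 * s / n) * (u x * Q.L (fun x => Real.log (u x)) x) - s ^ 2 / n * u x := by ring
    rw [h5, h2] at h4
    linear_combination 2 * h4
  have hmono := integral_mono (((hLi.const_mul (2 * κ)).sub' (hWi.const_mul _)).sub'
    (hui.const_mul _)) hPi hlow
  rw [integral_sub ((hLi.const_mul _).sub' (hWi.const_mul _)) (hui.const_mul _),
    integral_sub (hLi.const_mul _) (hWi.const_mul _), integral_const_mul, integral_const_mul,
    integral_const_mul, hQ.integral_L hub, hQ.integral_mul_L_log hub hul, hint, ← hs] at hmono
  have := mul_le_mul_of_nonneg_left hmono hε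
  linear_combination this

theorem integral_resolvent (hQ : Q.Regular μ) {f u : X → ℝ} {ε : ℝ} (hu : IsBoundedFun u)
    (heq : ∀ x, u x - ε * Q.L u x = f x) : ∫ x, f x ∂μ = ∫ x, u x ∂μ := by
  simp only [← heq]
  rw [integral_sub hu.integrable ((hQ.integrable_L hu).const_mul ε), integral_const_mul,
    hQ.integral_L hu, mul_zero, sub_zero]

/-- Test the equation with f - u = -εLu; on each jump 2 d(f-u) du ≤ (df)² - (du)². The squared step
sizes are thus controlled by a telescoping quantity. -/
theorem energy_resolvent_step (hQ : Q.Regular μ) {f u : X → ℝ} {ε : ℝ} (hε : 0 ≤ ε)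
    (hf : IsBoundedFun f) (hu : IsBoundedFun u) (heq : ∀ x, u x - ε * Q.L u x = f x) :
    2 * ∫ x, (f x - u x) ^ 2 ∂μ ≤ ε * (Q.energy μ f - Q.energy μ u) := by
  have hg := hf.sub hu
  have h1 := hQ.integral_mul_L_eq_neg hu hg
  have h2 : ∫ x, (f x - u x) ^ 2 ∂μ = -ε * ∫ x, (f x - u x) * Q.L u x ∂μ := by
    rw [← integral_const_mul]
    refine integral_congr_ae (.of_forall fun x => ?_)
    simp only
    rw [← heq x]
    ring
  have hfi := hQ.integrable_bounded ((bounded_diff hf).pow 2)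
  have hui := hQ.integrable_bounded ((bounded_diff hu).pow 2)
  have hgi := hQ.integrable_bounded ((bounded_diff hg).mul (bounded_diff hu))
  have h3 := integral_mono (hgi.const_mul 2) (hfi.sub' hui) fun p => by
    nlinarith [sq_nonneg ((f p.2 - f p.1) - (u p.2 - u p.1))]
  rw [integral_const_mul, integral_sub hfi hui] at h3
  have h4 : -2 * ∫ x, (f x - u x) * Q.L u x ∂μ ≤ Q.energy μ f - Q.energy μ u := by
    rw [h1]
    unfold energy
    linarith
  have := mul_le_mul_of_nonneg_left h4 hε
  rw [h2]
  linarith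

/-- Convexity of r log r produces log f instead of log u. As log is 1/c-Lipschitz on [c,∞), the
exchange costs the quadratic term. -/
theorem entropy_resolvent_step (hQ : Q.Regular μ) {f u : X → ℝ} {c C ε : ℝ} (hc : 0 < c)
    (hf : ∀ x, f x ∈ Set.Icc c C) (hu : ∀ x, u x ∈ Set.Icc c C)
    (heq : ∀ x, u x - ε * Q.L u x = f x) :
    entropy μ f - entropy μ u ≤ ε * Q.fisher μ u + (∫ x, (f x - u x) ^ 2 ∂μ) / c := by
  have hu0 x : 0 < u x := hc.trans_le (hu x).1
  have hf0 x : 0 < f x := hc.trans_le (hf x).1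
  have hub := IsBoundedFun.of_mem_Icc hu
  have hfb := IsBoundedFun.of_mem_Icc hf
  have hul := IsBoundedFun.log_of_mem_Icc hc hu
  have hfl := IsBoundedFun.log_of_mem_Icc hc hf
  have hi1 : Integrable (fun x => f x * Real.log (f x)) μ := (hfb.mul hfl).integrable
  have hi2 : Integrable (fun x => u x * Real.log (u x)) μ := (hub.mul hul).integrable
  have hi3 : Integrable (fun x => (f x - u x) ^ 2) μ := ((hfb.sub hub).pow 2).integrable
  have hi4 := hQ.integrable_mul_L hub hul
  have hi5 := hQ.integrable_L hub
  have hle : ∀ x, f x * Real.log (f x) - u x * Real.log (u x) ≤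
      (f x - u x) ^ 2 / c - ε * (Real.log (u x) * Q.L u x) - ε * Q.L u x := by
    intro x
    have h1 := mul_log_sub_le (hf0 x) (hu0 x)
    have h2 := sub_mul_log_sub_log_le hc (hf x).1 (hu x).1
    have h3 := heq x
    have h4 : f x - u x = -(ε * Q.L u x) := by linarith
    have h5 : (Real.log (f x) + 1) * (f x - u x) = (f x - u x) * (Real.log (f x) - Real.log (u x))
      + (f x - u x) * Real.log (u x) + (f x - u x) := by ring
    rw [h5] at h1
    -- The first factor f - u stays, for the quadratic error; after this rewrite the third
    -- occurrence has become the second.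
    nth_rw 2 [h4] at h1
    nth_rw 2 [h4] at h1
    linarith
  have h := integral_mono (hi1.sub' hi2)
    (((hi3.div_const c).sub' (hi4.const_mul ε)).sub' (hi5.const_mul ε)) hle
  rw [integral_sub hi1 hi2, integral_sub ((hi3.div_const c).sub' (hi4.const_mul ε))
    (hi5.const_mul ε), integral_sub (hi3.div_const c) (hi4.const_mul ε), integral_div,
    integral_const_mul, integral_const_mul, hQ.integral_L hub, hQ.integral_log_mul_L hub hul] at h
  unfold entropy
  linarith

end Regular

end MarkovGenerator
end

/-! ### The entropy-information inequality. -/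

noncomputable section

/-- Discrete form of d/dt (n/2) log(1 + I/(nκ)) ≤ -I. With s = 2εI'/n the hypothesis factors as (1 +
I'/(nκ))(1 + s) ≤ 1 + I/(nκ), and the error (n/2)s² = 2ε²I'²/n is at most ε(I - I'), which
telescopes. -/
theorem log_decrease_of_quadratic_decrease {κ n ε I I' : ℝ} (hκ : 0 < κ) (hn : 0 < n)
    (hε : 0 < ε) (hI' : 0 ≤ I') (h : I' + 2 * ε * (κ * I' + I' ^ 2 / n) ≤ I) :
    n / 2 * Real.log (1 + I' / (n * κ)) + ε * I' ≤
      n / 2 * Real.log (1 + I / (n * κ)) + ε * (I - I') := by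
  set s : ℝ := 2 * ε * I' / n with hs
  have hs0 : 0 ≤ s := by positivity
  have h1 : (1 + I' / (n * κ)) * (1 + s) ≤ 1 + I / (n * κ) := by
    have e : (1 + I' / (n * κ)) * (1 + s) =
        1 + (I' + 2 * ε * (κ * I' + I' ^ 2 / n)) / (n * κ) := by
      rw [hs]
      field_simp
      ring
    rw [e]
    gcongr
  have h2 : Real.log (1 + I' / (n * κ)) + Real.log (1 + s) ≤ Real.log (1 + I / (n * κ)) := by
    rw [← Real.log_mul (by positivity) (by positivity)]
    exact Real.log_le_log (by positivity) h1
  have h3 : s - s ^ 2 ≤ Real.log (1 + s) := by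
    refine le_trans ?_ (Real.one_sub_inv_le_log_of_pos (by positivity))
    have : 1 - (1 + s)⁻¹ - (s - s ^ 2) = s ^ 3 / (1 + s) := by
      field_simp
      ring
    have h0 : 0 ≤ s ^ 3 / (1 + s) := by positivity
    linarith
  have h4 : n / 2 * s = ε * I' := by rw [hs]; field_simp
  have h5 : n / 2 * s ^ 2 ≤ ε * (I - I') := by
    have e : n / 2 * s ^ 2 = ε * (2 * ε * (I' ^ 2 / n)) := by rw [hs]; field_simp
    rw [e]
    refine mul_le_mul_of_nonneg_left ?_ hε.le
    have : 0 ≤ 2 * ε * (κ * I') := by positivity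
    linarith
  have h6 := mul_le_mul_of_nonneg_left h2 (show 0 ≤ n / 2 by positivity)
  have h7 := mul_le_mul_of_nonneg_left h3 (show 0 ≤ n / 2 by positivity)
  linarith

namespace MarkovGenerator

variable {X : Type*} {Q : MarkovGenerator X} [Countable X] [MeasurableSpace X]
  [DiscreteMeasurableSpace X] {μ : Measure X} [IsProbabilityMeasure μ]

namespace Regular

theorem sq_sub_le_fisher (hQ : Q.Regular μ) {u : X → ℝ} {c C : ℝ} (hc : 0 < c)
    (hu : ∀ x, u x ∈ Set.Icc c C) {a b : X} (hab : a ≠ b) (hk : 0 < Q.k a b) :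
    (u b - u a) ^ 2 ≤ 2 * C / (μ.real {a} * Q.k a b) * Q.fisher μ u := by
  have hu0 x : 0 < u x := hc.trans_le (hu x).1
  have hub := IsBoundedFun.of_mem_Icc hu
  have hul := IsBoundedFun.log_of_mem_Icc hc hu
  have hi := hQ.integrable_bounded ((bounded_diff hub).mul (bounded_diff hul))
  have hC : 0 < C := (hu0 a).trans_le (hu a).2
  have hθ (p : X × X) : (u p.2 - u p.1) ^ 2 / C ≤
      (u p.2 - u p.1) * (Real.log (u p.2) - Real.log (u p.1)) :=
    le_sub_mul_log_sub_log (hu0 _) (hu0 _) (hu _).2 (hu _).2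
  have h1 := (hQ.integrable_iff.1 hi).le_tsum (a, b) fun p _ =>
    mul_nonneg (mul_nonneg measureReal_nonneg (Q.rate_nonneg _ _))
      ((div_nonneg (sq_nonneg _) hC.le).trans (hθ p))
  rw [← hQ.integral_eq_tsum hi] at h1
  simp only [Q.rate_of_ne hab.symm] at h1
  have hm : 0 < μ.real {a} * Q.k a b := mul_pos (hQ.pos a) hk
  have h2 := (mul_le_mul_of_nonneg_left (hθ (a, b)) hm.le).trans h1
  have h3 : μ.real {a} * Q.k a b * ((u b - u a) ^ 2 / C) ≤ 2 * Q.fisher μ u := by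
    unfold fisher
    linarith
  rw [div_mul_eq_mul_div, le_div_iff₀ hm]
  rw [← mul_div_assoc, div_le_iff₀ hC] at h3
  linarith

/-- Vanishing Fisher information forces increments along edges, hence along paths, to 0. The unit
integral makes the limiting constant 1, where r log r vanishes. -/
theorem tendsto_entropy (hQ : Q.Regular μ) (hirr : Q.Irreducible) {u : ℕ → X → ℝ} {c C : ℝ}
    (hc : 0 < c) (hu : ∀ k x, u k x ∈ Set.Icc c C) (hint : ∀ k, ∫ x, u k x ∂μ = 1)
    (hlim : Filter.Tendsto (fun k => Q.fisher μ (u k)) Filter.atTop (nhds 0)) :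
    Filter.Tendsto (fun k => entropy μ (u k)) Filter.atTop (nhds 0) := by
  have hedge : ∀ a b, a ≠ b ∧ 0 < Q.k a b →
      Filter.Tendsto (fun k => u k b - u k a) Filter.atTop (nhds 0) := by
    rintro a b ⟨hab, hk⟩
    have h1 : Filter.Tendsto (fun k => (u k b - u k a) ^ 2) Filter.atTop (nhds 0) := by
      refine squeeze_zero (fun k => sq_nonneg _)
        (fun k => hQ.sq_sub_le_fisher hc (hu k) hab hk) ?_
      simpa using hlim.const_mul (2 * C / (μ.real {a} * Q.k a b))
    have h2 := h1.sqrt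
    simp only [Real.sqrt_sq_eq_abs, Real.sqrt_zero] at h2
    exact (tendsto_zero_iff_abs_tendsto_zero _).2 h2
  have hpath : ∀ x y, Filter.Tendsto (fun k => u k y - u k x) Filter.atTop (nhds 0) := by
    intro x y
    induction hirr x y with
    | refl => simp
    | tail _ hbc ih => simpa using (hedge _ _ hbc).add ih
  have hone : ∀ x, Filter.Tendsto (fun k => u k x) Filter.atTop (nhds 1) := by
    intro x
    have h := tendsto_integral_of_dominated_convergence (μ := μ)
      (F := fun k y => u k y - u k x) (f := fun _ => 0) (fun _ => C - c)
      (fun _ => .of_discrete) (integrable_const _)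
      (fun k => .of_forall fun y => by
        rw [Real.norm_eq_abs, abs_le]
        constructor <;> linarith [(hu k y).1, (hu k y).2, (hu k x).1, (hu k x).2])
      (.of_forall fun y => hpath x y)
    have e (k : ℕ) : ∫ y, (u k y - u k x) ∂μ = 1 - u k x := by
      rw [integral_sub (IsBoundedFun.of_mem_Icc (hu k)).integrable (integrable_const _), hint]
      simp
    simp only [e, integral_zero] at h
    simpa using (h.const_sub 1)
  obtain ⟨D, hD⟩ := isCompact_Icc.exists_bound_of_continuousOn (s := Set.Icc c C)
    Real.continuous_mul_log.continuousOn
  have h := tendsto_integral_of_dominated_convergence (μ := μ)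
    (F := fun k y => u k y * Real.log (u k y)) (f := fun _ => 1 * Real.log 1) (fun _ => D)
    (fun _ => .of_discrete) (integrable_const _)
    (fun k => .of_forall fun y => hD _ (hu k y))
    (.of_forall fun y => (Real.continuous_mul_log.tendsto 1).comp (hone y))
  simpa [entropy] using h

theorem entropy_le_add (hQ : Q.Regular μ) (hirr : Q.Irreducible) {κ n : ℝ} (hκ : 0 < κ)
    (hn : 0 < n) (hCD : Q.CDUpsilonDim κ n) {f : X → ℝ} {c C : ℝ} (hc : 0 < c)
    (hf : ∀ x, f x ∈ Set.Icc c C) (hint : ∫ x, f x ∂μ = 1) {ε : ℝ} (hε : 0 < ε) :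
    entropy μ f ≤ n / 2 * Real.log (1 + Q.fisher μ f / (n * κ)) +
      ε * (Q.fisher μ f + Q.energy μ f / (2 * c)) := by
  -- The resolvent is chosen on functions with values in [c, C], so that it can be iterated.
  choose S hS hSeq using fun v : {v : X → ℝ // ∀ x, v x ∈ Set.Icc c C} =>
    exists_resolvent (Q := Q) hε.le v.2
  let U : ℕ → {v : X → ℝ // ∀ x, v x ∈ Set.Icc c C} :=
    fun k => (fun v => ⟨S v, hS v⟩)^[k] ⟨f, hf⟩
  let u : ℕ → X → ℝ := fun k => (U k).1
  have hu0 : u 0 = f := rfl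
  have hu (k : ℕ) (x : X) : u k x ∈ Set.Icc c C := (U k).2 x
  have hb (k : ℕ) : IsBoundedFun (u k) := IsBoundedFun.of_mem_Icc (hu k)
  have hus (k : ℕ) (x : X) : u (k + 1) x - ε * Q.L (u (k + 1)) x = u k x := by
    have : u (k + 1) = S (U k) := by
      simp only [u, U]
      rw [Function.iterate_succ_apply']
    rw [this]
    exact hSeq (U k) x
  have hui (k : ℕ) : ∫ x, u k x ∂μ = 1 := by
    induction k with
    | zero => exact hint
    | succ k ih => rw [← hQ.integral_resolvent (hb (k + 1)) (hus k), ih]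
  have hI0 (k : ℕ) : 0 ≤ Q.fisher μ (u k) := fisher_nonneg fun x => hc.trans_le (hu k x).1
  have hI (k : ℕ) := hQ.fisher_resolvent_step hn hCD hc hε.le (hu k) (hu (k + 1)) (hus k)
    (hui (k + 1))
  have hlim : Filter.Tendsto (fun k => Q.fisher μ (u k)) Filter.atTop (nhds 0) := by
    have hr : (0 : ℝ) < 1 + 2 * ε * κ := by positivity
    have hgeo (k : ℕ) : Q.fisher μ (u k) ≤ Q.fisher μ f * (1 + 2 * ε * κ)⁻¹ ^ k := by
      induction k with
      | zero => simp [hu0]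
      | succ k ih =>
        have h1 : Q.fisher μ (u (k + 1)) ≤ Q.fisher μ (u k) * (1 + 2 * ε * κ)⁻¹ := by
          rw [← div_eq_mul_inv, le_div_iff₀ hr]
          have h2 : 0 ≤ 2 * ε * (Q.fisher μ (u (k + 1)) ^ 2 / n) := by positivity
          linarith [hI k]
        rw [pow_succ, ← mul_assoc]
        exact h1.trans (mul_le_mul_of_nonneg_right ih (inv_nonneg.2 hr.le))
    refine squeeze_zero hI0 hgeo ?_
    have := (tendsto_pow_atTop_nhds_zero_of_lt_one (inv_nonneg.2 hr.le)
      (inv_lt_one_of_one_lt₀ (show (1 : ℝ) < 1 + 2 * ε * κ by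
        have : 0 < 2 * ε * κ := by positivity
        linarith))).const_mul (Q.fisher μ f)
    simpa using this
  -- The entropy minus the desired bound, with the telescoping errors of the log and entropy steps
  -- built in. It increases along the iteration and is at most the entropy, which tends to 0.
  let V : ℕ → ℝ := fun k => entropy μ (u k) -
    n / 2 * Real.log (1 + Q.fisher μ (u k) / (n * κ)) -
    ε * (Q.fisher μ (u k) + Q.energy μ (u k) / (2 * c))
  have hV : Monotone V := by
    refine monotone_nat_of_le_succ fun k => ?_
    have h1 := log_decrease_of_quadratic_decrease hκ hn hε (hI0 (k + 1)) (hI k)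
    have h2 := hQ.entropy_resolvent_step hc (hu k) (hu (k + 1)) (hus k)
    have h3 := hQ.energy_resolvent_step hε.le (hb k) (hb (k + 1)) (hus k)
    have h4 : (∫ x, (u k x - u (k + 1) x) ^ 2 ∂μ) / c ≤
        ε * (Q.energy μ (u k) / (2 * c) - Q.energy μ (u (k + 1)) / (2 * c)) := by
      rw [div_le_iff₀ hc]
      have : ε * (Q.energy μ (u k) / (2 * c) - Q.energy μ (u (k + 1)) / (2 * c)) * c =
          ε * (Q.energy μ (u k) - Q.energy μ (u (k + 1))) / 2 := by
        field_simp
      linarith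
    simp only [V]
    linarith
  have hVle (k : ℕ) : V 0 ≤ entropy μ (u k) := by
    refine (hV k.zero_le).trans ?_
    have h1 : 0 ≤ n / 2 * Real.log (1 + Q.fisher μ (u k) / (n * κ)) := by
      refine mul_nonneg (by positivity) (Real.log_nonneg ?_)
      have := div_nonneg (hI0 k) (mul_pos hn hκ).le
      linarith
    have h2 : 0 ≤ ε * (Q.fisher μ (u k) + Q.energy μ (u k) / (2 * c)) :=
      mul_nonneg hε.le (add_nonneg (hI0 k) (div_nonneg (energy_nonneg μ _) (by positivity)))
    simp only [V]
    linarith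
  have := ge_of_tendsto' (hQ.tendsto_entropy hirr hc hu hui hlim) hVle
  simp only [V, hu0] at this
  linarith

/-- The entropy-information inequality. -/
theorem entropy_le_log_fisher (hQ : Q.Regular μ) (hirr : Q.Irreducible) {κ n : ℝ} (hκ : 0 < κ)
    (hn : 0 < n) (hCD : Q.CDUpsilonDim κ n) {f : X → ℝ} {c C : ℝ} (hc : 0 < c)
    (hf : ∀ x, f x ∈ Set.Icc c C) (hint : ∫ x, f x ∂μ = 1) :
    entropy μ f ≤ n / 2 * Real.log (1 + Q.fisher μ f / (n * κ)) := by
  refine le_of_forall_pos_le_add fun δ hδ => ?_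
  set A := Q.fisher μ f + Q.energy μ f / (2 * c) with hA
  have hA0 : 0 ≤ A := add_nonneg (fisher_nonneg fun x => hc.trans_le (hf x).1)
    (div_nonneg (energy_nonneg μ _) (by positivity))
  -- The lower bound c of f enters only through A, so it disappears as ε → 0.
  have h := hQ.entropy_le_add hirr hκ hn hCD hc hf hint (ε := δ / (A + 1)) (by positivity)
  refine h.trans (add_le_add_right ?_ _)
  rw [← hA, div_mul_eq_mul_div, div_le_iff₀ (by positivity)]
  nlinarith

end Regular

end MarkovGenerator
end

/-! ### The Herbst argument and the diameter bound. -/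

noncomputable section

/-- The logarithmic mean is at most the arithmetic mean, from log(1+x) ≥ 2x/(x+2). -/
theorem sub_mul_log_sub_log_le_sq_mul_add {a b : ℝ} (ha : 0 < a) (hb : 0 < b) :
    (b - a) * (Real.log b - Real.log a) ≤ (Real.log b - Real.log a) ^ 2 * ((a + b) / 2) := by
  wlog h : a ≤ b generalizing a b
  · have := this hb ha (le_of_not_ge h)
    linear_combination this
  have h1 := Real.le_log_one_add_of_nonneg (x := (b - a) / a) (div_nonneg (by linarith) ha.le)
  have e1 : 1 + (b - a) / a = b / a := by field_simp; ring
  have e2 : 2 * ((b - a) / a) / ((b - a) / a + 2) = 2 * (b - a) / (a + b) := by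
    have e3 : (b - a) / a + 2 = (a + b) / a := by field_simp; ring
    rw [e3]
    field_simp
  rw [e1, e2, Real.log_div hb.ne' ha.ne', div_le_iff₀ (by positivity)] at h1
  have h2 : 0 ≤ Real.log b - Real.log a := sub_nonneg.2 (Real.log_le_log ha h)
  have := mul_le_mul_of_nonneg_right h1 h2
  linarith

section Herbst

variable {Ω : Type*} [MeasurableSpace Ω] {μ : Measure Ω} [IsProbabilityMeasure μ] {h : Ω → ℝ}

theorem integrableExpSet_eq_univ_of_bounded (hm : Measurable h) (hb : IsBoundedFun h) :
    integrableExpSet h μ = Set.univ := by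
  refine Set.eq_univ_of_forall fun t => ?_
  obtain ⟨C, hC⟩ := ((IsBoundedFun.const t).mul hb).continuous_comp Real.continuous_exp
  exact Integrable.of_bound (by fun_prop) C (.of_forall hC)

theorem hasDerivAt_cgf_of_bounded (hm : Measurable h) (hb : IsBoundedFun h) (t : ℝ) :
    HasDerivAt (cgf h μ) ((∫ x, h x * Real.exp (t * h x) ∂μ) / mgf h μ t) t := by
  have hi : t ∈ interior (integrableExpSet h μ) := by
    simp [integrableExpSet_eq_univ_of_bounded hm hb]
  have hexp : Integrable (fun x => Real.exp (t * h x)) μ :=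
    interior_subset (s := integrableExpSet h μ) hi
  exact (hasDerivAt_mgf hi).log (mgf_pos hexp).ne'

/-- The Herbst argument for the entropy bound `c log (1 + b² t²)`. -/
theorem cgf_div_le_of_entropy_le (hm : Measurable h) (hb : IsBoundedFun h) {b c : ℝ} (hb0 : 0 < b)
    (hc : 0 ≤ c)
    (H : ∀ t, 0 < t → t * deriv (cgf h μ) t - cgf h μ t ≤ c * Real.log (1 + b ^ 2 * t ^ 2))
    {t : ℝ} (ht : 0 < t) : cgf h μ t / t ≤ ∫ x, h x ∂μ + c * (b * Real.pi) := by
  -- A primitive of c log(1 + b²s²)/s² which tends to 0 at 0 and to cbπ at infinity.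
  let A : ℝ → ℝ := fun s => c * (2 * b * Real.arctan (b * s) - Real.log (1 + b ^ 2 * s ^ 2) / s)
  have hG (s : ℝ) : HasDerivAt (cgf h μ) (deriv (cgf h μ) s) s :=
    (hasDerivAt_cgf_of_bounded hm hb s).differentiableAt.hasDerivAt
  have hA (s : ℝ) (hs : 0 < s) : HasDerivAt A (c * Real.log (1 + b ^ 2 * s ^ 2) / s ^ 2) s := by
    have h0 : 0 < 1 + b ^ 2 * s ^ 2 := by positivity
    have h1 : HasDerivAt (fun s : ℝ => b * s) b s := by
      simpa using (hasDerivAt_id s).const_mul b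
    have h2 : HasDerivAt (fun s : ℝ => 1 + b ^ 2 * s ^ 2) (b ^ 2 * (2 * s)) s := by
      simpa using ((hasDerivAt_pow 2 s).const_mul (b ^ 2)).const_add 1
    have h3 := (((h1.arctan).const_mul (2 * b)).sub
      ((h2.log h0.ne').div (hasDerivAt_id s) hs.ne')).const_mul c
    refine h3.congr_deriv ?_
    have h4 : 1 + (b * s) ^ 2 ≠ 0 := by positivity
    simp only [id, mul_one]
    field_simp
    ring
  have hD (s : ℝ) (hs : 0 < s) := ((hG s).div (hasDerivAt_id s) hs.ne').sub (hA s hs)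
  let D : ℝ → ℝ := cgf h μ / id - A
  have hanti : AntitoneOn D (Set.Ioi 0) := by
    refine antitoneOn_of_deriv_nonpos (convex_Ioi 0)
      (fun s hs => (hD s hs).continuousAt.continuousWithinAt)
      (fun s hs => (hD s (interior_subset hs)).differentiableAt.differentiableWithinAt)
      fun s hs => ?_
    have hs' : 0 < s := interior_subset hs
    rw [(hD s hs').deriv]
    simp only [id, mul_one]
    rw [← sub_div]
    refine div_nonpos_of_nonpos_of_nonneg ?_ (sq_nonneg s)
    linarith [H s hs']
  have hlow (s : ℝ) (hs : 0 < s) : -A s ≤ c * b ^ 2 * s := by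
    have h1 : Real.log (1 + b ^ 2 * s ^ 2) / s ≤ b ^ 2 * s := by
      rw [div_le_iff₀ hs]
      have := Real.log_le_sub_one_of_pos (show 0 < 1 + b ^ 2 * s ^ 2 by positivity)
      linarith
    have h2 : 0 ≤ Real.arctan (b * s) := Real.arctan_nonneg.2 (by positivity)
    have h3 : Real.log (1 + b ^ 2 * s ^ 2) / s - 2 * b * Real.arctan (b * s) ≤ b ^ 2 * s := by
      have := mul_nonneg (mul_nonneg zero_le_two hb0.le) h2
      linarith
    have := mul_le_mul_of_nonneg_left h3 hc
    simp only [A]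
    linarith
  have hup : A t ≤ c * (b * Real.pi) := by
    refine mul_le_mul_of_nonneg_left ?_ hc
    have h1 : 0 ≤ Real.log (1 + b ^ 2 * t ^ 2) / t :=
      div_nonneg (Real.log_nonneg (by have : 0 ≤ b ^ 2 * t ^ 2 := by positivity
                                      linarith)) ht.le
    have h2 := mul_le_mul_of_nonneg_left (Real.arctan_lt_pi_div_two (b * t)).le
      (mul_nonneg zero_le_two hb0.le)
    linarith
  -- As the cumulant function vanishes at 0, its quotient by s tends to its derivative there, the
  -- mean of h.
  have hlim : Filter.Tendsto (fun s => s⁻¹ • (cgf h μ (0 + s) - cgf h μ 0) + c * b ^ 2 * s)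
      (nhdsWithin 0 (Set.Ioi 0)) (nhds (∫ x, h x ∂μ + c * b ^ 2 * 0)) := by
    refine Filter.Tendsto.add ?_ ?_
    · have := (hasDerivAt_cgf_of_bounded (μ := μ) hm hb 0).tendsto_slope_zero_right
      simpa using this
    · exact tendsto_nhdsWithin_of_tendsto_nhds ((continuous_const.mul continuous_id).tendsto _)
  have hle : D t ≤ ∫ x, h x ∂μ + c * b ^ 2 * 0 := by
    refine ge_of_tendsto hlim ?_
    filter_upwards [Ioc_mem_nhdsGT ht] with s hs
    have h1 := hanti (Set.mem_Ioi.2 hs.1) (Set.mem_Ioi.2 ht) hs.2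
    refine h1.trans ?_
    have := hlow s hs.1
    simp only [D, Pi.sub_apply, Pi.div_apply, id, zero_add, cgf_zero, sub_zero, smul_eq_mul]
    rw [← div_eq_inv_mul]
    linarith
  simp only [D, Pi.sub_apply, Pi.div_apply, id] at hle
  linarith

end Herbst

namespace MarkovGenerator

variable {X : Type*} {Q : MarkovGenerator X}

theorem Gam_eq_jumpSum (h : X → ℝ) (x : X) :
    Q.Gam h x = Q.jumpSum (fun p => (h p.2 - h p.1) ^ 2 / 2) x :=
  Q.Psi_eq_jumpSum (H := fun r => r ^ 2 / 2) (by simp) h x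

variable [Countable X] [MeasurableSpace X] [DiscreteMeasurableSpace X]
  {μ : Measure X} [IsProbabilityMeasure μ]

namespace Regular

/-- The mean comparison bounds I(f) by t² times the average of ∫ f(x)(h(y)-h(x))²/2 and its
reversal; each equals ∫ f Γ(h) dμ ≤ 1. -/
theorem fisher_le_of_Gam_le_one (hQ : Q.Regular μ) {h f : X → ℝ} (hh : IsBoundedFun h)
    (hf : IsBoundedFun f) (hpos : ∀ x, 0 < f x) (hint : ∫ x, f x ∂μ = 1) {t r : ℝ}
    (hlog : ∀ x, Real.log (f x) = t * h x - r) (hΓ : ∀ x, Q.Gam h x ≤ 1) :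
    Q.fisher μ f ≤ t ^ 2 := by
  let F : X × X → ℝ := fun p => f p.1 * ((h p.2 - h p.1) ^ 2 / 2)
  have hhd := (bounded_diff hh).pow 2
  have hF : Integrable F (Q.jumpMeasure μ) :=
    hQ.integrable_bounded ((hf.comp Prod.fst).mul (by
      simpa only [div_eq_mul_inv] using hhd.mul (IsBoundedFun.const (2 : ℝ)⁻¹)))
  have hFs := hQ.integrable_swap hF
  have hlogb : IsBoundedFun fun x => Real.log (f x) := by
    simp only [hlog]
    exact ((IsBoundedFun.const t).mul hh).sub (IsBoundedFun.const r)
  have hle (p : X × X) : (f p.2 - f p.1) * (Real.log (f p.2) - Real.log (f p.1)) ≤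
      t ^ 2 * (F p + F p.swap) := by
    have h1 := sub_mul_log_sub_log_le_sq_mul_add (hpos p.1) (hpos p.2)
    have h2 : (Real.log (f p.2) - Real.log (f p.1)) ^ 2 = t ^ 2 * (h p.2 - h p.1) ^ 2 := by
      rw [hlog, hlog]
      ring
    rw [h2] at h1
    simp only [F, Prod.fst_swap, Prod.snd_swap]
    linear_combination h1
  have h1 := integral_mono (hQ.integrable_bounded ((bounded_diff hf).mul (bounded_diff hlogb)))
    ((hF.add hFs).const_mul (t ^ 2)) hle
  have h2 : ∫ p, (F + fun p : X × X => F p.swap) p ∂Q.jumpMeasure μ = 2 * ∫ p, F p ∂Q.jumpMeasure μ := by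
    rw [integral_add' hF hFs, hQ.integral_swap hF]
    ring
  rw [integral_const_mul, h2] at h1
  have h3 : ∫ p, F p ∂Q.jumpMeasure μ ≤ 1 := by
    rw [← hQ.integral_jumpSum hF, ← hint]
    refine integral_mono (hQ.integrable_jumpSum hF) hf.integrable fun x => ?_
    have := Q.jumpSum_left_mul f (fun p => (h p.2 - h p.1) ^ 2 / 2) x
    simp only [F]
    rw [this, ← Gam_eq_jumpSum]
    exact mul_le_of_le_one_right (hpos x).le (hΓ x)
  have h4 := mul_le_mul_of_nonneg_left h3 (sq_nonneg t)
  unfold fisher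
  linarith

theorem entropy_cgf_le (hQ : Q.Regular μ) (hirr : Q.Irreducible) {κ n : ℝ} (hκ : 0 < κ)
    (hn : 0 < n) (hCD : Q.CDUpsilonDim κ n) {h : X → ℝ} (hh : IsBoundedFun h)
    (hΓ : ∀ x, Q.Gam h x ≤ 1) (t : ℝ) :
    t * deriv (cgf h μ) t - cgf h μ t ≤ n / 2 * Real.log (1 + t ^ 2 / (n * κ)) := by
  have hm : Measurable h := .of_discrete
  set r := cgf h μ t with hr
  have hexp : Integrable (fun x => Real.exp (t * h x)) μ := by
    have : t ∈ integrableExpSet h μ := by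
      simp [integrableExpSet_eq_univ_of_bounded hm hh]
    exact this
  have hZ : mgf h μ t = Real.exp r := (exp_cgf hexp).symm
  -- The normalised density e^{th}/Z with log Z = r; its entropy is t G'(t) - G(t) for G the
  -- cumulant function.
  let f : X → ℝ := fun x => Real.exp (t * h x - r)
  have hf (x : X) : f x = Real.exp (t * h x) / Real.exp r := Real.exp_sub _ _
  have hlb : IsBoundedFun fun x => t * h x - r :=
    ((IsBoundedFun.const t).mul hh).sub (IsBoundedFun.const r)
  obtain ⟨C, hC⟩ := hlb
  have hfI (x : X) : f x ∈ Set.Icc (Real.exp (-C)) (Real.exp C) :=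
    ⟨Real.exp_le_exp.2 (abs_le.1 (hC x)).1, Real.exp_le_exp.2 (abs_le.1 (hC x)).2⟩
  have hfb := IsBoundedFun.of_mem_Icc hfI
  have hlog (x : X) : Real.log (f x) = t * h x - r := Real.log_exp _
  have hint : ∫ x, f x ∂μ = 1 := by
    simp only [hf]
    rw [integral_div, ← hZ]
    exact div_self (mgf_pos hexp).ne'
  have hent : entropy μ f = t * deriv (cgf h μ) t - r := by
    have e (x : X) : f x * Real.log (f x) =
        t * ((h x * Real.exp (t * h x)) / Real.exp r) - r * f x := by
      rw [hlog, hf]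
      ring
    have hi : Integrable (fun x => h x * Real.exp (t * h x)) μ := hh.mul_integrable hexp
    unfold entropy
    simp only [e]
    rw [integral_sub ((hi.div_const _).const_mul t) (hfb.integrable.const_mul r),
      integral_const_mul, integral_const_mul, integral_div, hint, mul_one, ← hZ,
      (hasDerivAt_cgf_of_bounded hm hh t).deriv]
  rw [← hent]
  refine (hQ.entropy_le_log_fisher hirr hκ hn hCD (Real.exp_pos _) hfI hint).trans ?_
  have hI0 : 0 ≤ Q.fisher μ f := fisher_nonneg fun x => Real.exp_pos _
  have hI := hQ.fisher_le_of_Gam_le_one hh hfb (fun x => Real.exp_pos _) hint hlog hΓ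
  gcongr

theorem sub_integral_le (hQ : Q.Regular μ) (hirr : Q.Irreducible) {κ n : ℝ} (hκ : 0 < κ)
    (hn : 0 < n) (hCD : Q.CDUpsilonDim κ n) {h : X → ℝ} (hh : IsBoundedFun h)
    (hΓ : ∀ x, Q.Gam h x ≤ 1) (y : X) :
    h y - ∫ x, h x ∂μ ≤ Real.pi * √(n / κ) / 2 := by
  have hm : Measurable h := .of_discrete
  have hnκ : 0 < n * κ := mul_pos hn hκ
  have hb : (√(n * κ)⁻¹) ^ 2 = (n * κ)⁻¹ := Real.sq_sqrt (inv_nonneg.2 hnκ.le)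
  have hcgf (t : ℝ) (ht : 0 < t) := cgf_div_le_of_entropy_le (μ := μ) hm hh
    (b := √(n * κ)⁻¹) (c := n / 2) (Real.sqrt_pos.2 (inv_pos.2 hnκ)) (by positivity)
    (fun s _ => by
      rw [hb, ← div_eq_inv_mul]
      exact hQ.entropy_cgf_le hirr hκ hn hCD hh hΓ s) ht
  have hconst : n / 2 * (√(n * κ)⁻¹ * Real.pi) = Real.pi * √(n / κ) / 2 := by
    have : n * √(n * κ)⁻¹ = √(n / κ) := by
      rw [eq_comm, Real.sqrt_eq_iff_mul_self_eq (by positivity) (by positivity)]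
      have : n * √(n * κ)⁻¹ * (n * √(n * κ)⁻¹) = n ^ 2 * (√(n * κ)⁻¹) ^ 2 := by ring
      rw [this, hb]
      field_simp
    rw [← this]
    ring
  -- Keeping only the atom y in E[e^{th}] shows that G(t)/t recovers h(y) as t → ∞.
  have hpt (t : ℝ) (ht : 0 < t) : h y + Real.log (μ.real {y}) / t ≤ cgf h μ t / t := by
    have hexp : Integrable (fun x => Real.exp (t * h x)) μ := by
      have : t ∈ integrableExpSet h μ := by
        simp [integrableExpSet_eq_univ_of_bounded hm hh]
      exact this
    have h1 : μ.real {y} * Real.exp (t * h y) ≤ mgf h μ t := by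
      rw [mgf, integral_countable hexp]
      exact ((integrable_iff_summable_of_countable μ _).1 hexp).le_tsum y fun x _ =>
        mul_nonneg measureReal_nonneg (Real.exp_pos _).le
    have h2 := Real.log_le_log (mul_pos (hQ.pos y) (Real.exp_pos _)) h1
    rw [Real.log_mul (hQ.pos y).ne' (Real.exp_pos _).ne', Real.log_exp] at h2
    rw [le_div_iff₀ ht, add_mul, div_mul_cancel₀ _ ht.ne', cgf]
    linarith
  have hlim : Filter.Tendsto (fun t : ℝ => h y + Real.log (μ.real {y}) / t) Filter.atTop
      (nhds (h y + 0)) :=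
    (Filter.Tendsto.div_atTop tendsto_const_nhds Filter.tendsto_id).const_add _
  have h1 := le_of_tendsto hlim ((Filter.eventually_gt_atTop 0).mono fun t ht =>
    (hpt t ht).trans (hcgf t ht))
  rw [hconst] at h1
  linarith

theorem sub_le_of_Gam_le_one (hQ : Q.Regular μ) (hirr : Q.Irreducible) {κ n : ℝ} (hκ : 0 < κ)
    (hn : 0 < n) (hCD : Q.CDUpsilonDim κ n) {h : X → ℝ} (hh : IsBoundedFun h)
    (hΓ : ∀ x, Q.Gam h x ≤ 1) (x y : X) : h y - h x ≤ Real.pi * √(n / κ) := by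
  have h1 := hQ.sub_integral_le hirr hκ hn hCD hh hΓ y
  have h2 := hQ.sub_integral_le hirr hκ hn hCD hh.neg (fun z => by
    rw [Gam_eq_jumpSum]
    refine le_trans (le_of_eq ?_) (hΓ z)
    rw [Gam_eq_jumpSum]
    congr 1
    ext p
    ring) x
  rw [integral_neg] at h2
  linarith

end Regular

/-- Some atom has positive mass, and detailed balance carries positivity across each edge of a path.
-/
theorem Irreducible.measureReal_singleton_pos (hirr : Q.Irreducible) (hμ : Q.DetailedBalance μ)
    (x : X) : 0 < μ.real {x} := by
  obtain ⟨x₀, h0⟩ : ∃ x₀, μ {x₀} ≠ 0 := by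
    by_contra! h
    have : μ = 0 := Measure.ext_of_singleton fun x => by simp [h]
    exact IsProbabilityMeasure.ne_zero μ this
  have h0' : 0 < μ.real {x₀} := ENNReal.toReal_pos h0 (measure_ne_top _ _)
  induction hirr x₀ x with
  | refl => exact h0'
  | tail _ hbc ih =>
    refine lt_of_le_of_ne measureReal_nonneg fun h => ?_
    have h1 := hμ _ _ |>.symm.trans_gt (mul_pos ih hbc.2)
    rw [← h, zero_mul] at h1
    exact lt_irrefl _ h1

theorem sq_clamp_sub_clamp_le (a b s t : ℝ) :
    (max (min s b) a - max (min t b) a) ^ 2 ≤ (s - t) ^ 2 := by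
  have h := ((LipschitzWith.id (α := ℝ)).min_const b).max_const a
  have := h.dist_le_mul s t
  simp only [id, NNReal.coe_one, one_mul, Real.dist_eq] at this
  exact sq_le_sq.2 this

/-- Clamping is a contraction. Summability for `h` is needed because a divergent `tsum` would be 0.
-/
theorem Gam_clamp_le {h : X → ℝ} {x : X}
    (hs : Summable fun y => Q.k x y * ((h y - h x) ^ 2 / 2)) (a b : ℝ) :
    Q.Gam (fun z => max (min (h z) b) a) x ≤ Q.Gam h x := by
  have hs' : Summable fun y => Q.rate x y * ((h y - h x) ^ 2 / 2) := by
    refine hs.congr fun y => ?_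
    by_cases hy : y = x
    · simp [hy]
    · rw [Q.rate_of_ne hy]
  have hle (y : X) : (max (min (h y) b) a - max (min (h x) b) a) ^ 2 / 2 ≤ (h y - h x) ^ 2 / 2 :=
    div_le_div_of_nonneg_right (sq_clamp_sub_clamp_le _ _ _ _) zero_le_two
  rw [Gam_eq_jumpSum, Gam_eq_jumpSum]
  refine Q.jumpSum_le (hs'.of_nonneg_of_le (fun y => ?_) fun y => ?_) hs' hle
  · exact mul_nonneg (Q.rate_nonneg x y) (by positivity)
  · exact mul_le_mul_of_nonneg_left (hle y) (Q.rate_nonneg x y)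

theorem Gam_le_one_of_lipNorm_le_one {f : X → ℝ} (hf : Q.IsLipschitz f) (hn : Q.lipNorm f ≤ 1)
    (x : X) : Q.Gam f x ≤ 1 :=
  (le_ciSup hf.2 x).trans (by simpa using (Real.sqrt_le_left zero_le_one).1 hn)

end MarkovGenerator
end

theorem mainTheorem7 {X : Type*} [Countable X] [MeasurableSpace X] [DiscreteMeasurableSpace X]
    (Q : MarkovGenerator X) (hirr : Q.Irreducible)
    (μ : Measure X) [IsProbabilityMeasure μ] (hμ : Q.DetailedBalance μ)
    (hM₁ : MemLp Q.M₁ 2 μ) (hM₂ : MemLp Q.M₂ 1 μ) (hrec : Q.PositiveRecurrent)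
    (κ n : ℝ) (hκ : 0 < κ) (hn : 0 < n) (hCD : Q.CDUpsilonDim κ n) :
    Q.diam ≤ ((Real.pi * √(n / κ) : ℝ) : EReal) := by
  have hQ : Q.Regular μ := ⟨hμ, hirr.measureReal_singleton_pos hμ, hM₁.integrable_sq⟩
  refine iSup_le fun x => iSup_le fun y => sSup_le ?_
  rintro _ ⟨f, ⟨hf, hf1⟩, rfl⟩
  rw [EReal.coe_le_coe_iff]
  rcases le_total (f y) (f x) with hle | hle
  · have : 0 ≤ Real.pi * √(n / κ) := by positivity
    linarith
  -- Clamping between f(x) and f(y) makes the function bounded without changing its values at x and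
  -- y.
  have hb : IsBoundedFun fun z => max (min (f z) (f y)) (f x) :=
    IsBoundedFun.of_mem_Icc (c := f x) (C := f y) fun z =>
      ⟨le_max_right _ _, max_le (min_le_right _ _) hle⟩
  have h := hQ.sub_le_of_Gam_le_one hirr hκ hn hCD hb (fun z =>
    (MarkovGenerator.Gam_clamp_le (hf.1 z) _ _).trans
      (MarkovGenerator.Gam_le_one_of_lipNorm_le_one hf hf1 z)) x y
  simpa [hle] using h
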